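/- **Classification of Bertrand surfaces.** For $c,d\in\mathbb R$ put $Q_{c,d}(\theta)=\theta^2+c-d\theta^{-2}$ and $I_{c,d}=\{\theta<0:\ Q_{c,d}(\theta)>0,\ Q_{c,d}'(\theta)\neq0\}$. For $\mu>0$ the Bertrand surface is $S_{c,d}=I_{c,d}\times S^1$, $S^1=\mathbb R/2\pi\mathbb Z$, with coordinates $(\theta,\varphi\bmod 2\pi)$ and the Riemannian metric $$ds^2_{\mu,c,d}=\frac{d\theta^2}{Q_{c,d}(\theta)^2}+\frac{d\varphi^2}{\mu^2Q_{c,d}(\theta)} .$$ Its meridians are the sets $I_{c,d}\times\{\varphi_0\}$, its parallels the sets $\{\theta_0\}\times S^1$. Isometries and similarities are $C^\infty$ diffeomorphisms; "isometric (similar) near subsets $P$ and $P'$" means that some neighbourhoods of $P$ and $P'$ are mapped onto each other by an isometry (a similarity, with some coefficient $\kappa>0$) that takes $P$ to $P'$ and takes arcs of meridians into meridians. Let $\gamma:[0,2\pi]\to\mathbb R^2$, $\gamma(\phi)=(c_\phi,d_\phi)$, be a not necessarily continuous map which meets every set $\{(lc,l^2d): l>0\}$, $(c,d)\in\mathbb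 R^2$, for exactly one value of $\phi$. Let $\Delta=c^2+4d$, $\Omega_1=\{\Delta>0,\ d<0<c\}$, $\Omega_3=\{c<0,\ d<0<\Delta\}$, $\Omega_4=\{\Delta<0\}$, $\ell_3=\{c<0=\Delta\}$, $\ell_4=\{\Delta=0<c\}$, $x_3=\sqrt{(-c+\sqrt\Delta)/2}$, $y_3=\sqrt{(-c-\sqrt\Delta)/2}$. **(A)** If $(\mu_i,c_i,d_i,\theta_i)$, $i=1,2$, are distinct, $\mu_i>0$, $\theta_i\in I_{c_i,d_i}$, then $(S_{c_1,d_1},ds^2_{\mu_1,c_1,d_1})$ and $(S_{c_2,d_2},ds^2_{\mu_2,c_2,d_2})$ are not isometric, with preservation of meridians, near the parallels $\{\theta_1\}\times S^1$ and $\{\theta_2\}\times S^1$. For all $\mu>0$, $c,d$ the surface $(S_{c,d},ds^2_{\mu,c,d})$ is locally isometric to $(S_{c,d},ds^2_{1,c,d})$; more precisely, some neighbourhood of every meridian embeds isometrically into the latter by $(\theta,\varphi)\mapsto(\theta,\varphi/\mu)$. If $(c_i,d_i,\theta_i)$, $i=1,2$, are distinct, $\theta_i\in I_{c_i,d_i}$,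 then $(S_{c_1,d_1},ds^2_{1,c_1,d_1})$ and $(S_{c_2,d_2},ds^2_{1,c_2,d_2})$ are not isometric, with preservation of meridians, near the points $(\theta_1,0)$ and $(\theta_2,0)$. **(B)** For every $(c,d)$ there is exactly one pair $(\lambda,\phi)\in\mathbb R_{>0}\times[0,2\pi]$, with $\lambda=1$ if $\gamma(\phi)=(0,0)$, such that $c=\lambda^2c_\phi$, $d=\lambda^4d_\phi$. For this pair and every $\mu>0$ the map $(\theta,\varphi)\mapsto(\theta/\lambda,\varphi)$ is an isometry of $(S_{c,d},\lambda^2ds^2_{\mu,c,d})$ onto $(S_{\gamma(\phi)},ds^2_{\mu,\gamma(\phi)})$, and $(S_{c,d},\lambda^2ds^2_{\mu,c,d})$ is locally isometric to $(S_{\gamma(\phi)},ds^2_{1,\gamma(\phi)})$. If $(\mu_i,\phi_i,\theta_i)$, $i=1,2$, are distinct, $\mu_i>0$, $\theta_i\in I_{\gamma(\phi_i)}$, and it is not the case that both $\mu_1=\mu_2$ and $\gamma(\phi_1)=\gamma(\phi_2)=(0,0)$, then the surfaces $(S_{\gamma(\phi_i)},ds^2_{\mu_i,\gamma(\phi_i)})$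 are not similar, with preservation of meridians, near the parallels $\{\theta_i\}\times S^1$. If $(\phi_i,\theta_i)$, $i=1,2$, are distinct, $\theta_i\in I_{\gamma(\phi_i)}$, and it is not the case that $\gamma(\phi_1)=\gamma(\phi_2)=(0,0)$, then the surfaces $(S_{\gamma(\phi_i)},ds^2_{1,\gamma(\phi_i)})$ are not similar, with preservation of meridians, near the points $(\theta_i,0)$. **(C)** Let $\mu>0$, $d_0=\operatorname{sgn}d$, and let $c_0\ge c_0(c,d)$, where $c_0(c,d)=0$ for $d=0$, $c_0(c,d)=-2$ for $d<0$, $c_0(c,d)=c/\sqrt d$ for $d>0$. Then $(S_{c,d},ds^2_{\mu,c,d})$ is projectively diffeomorphic (by a diffeomorphism under which unparametrized geodesics correspond to unparametrized geodesics) to an open part of $(S_{c_0,d_0},ds^2_{\mu,c_0,d_0})$, by the following map. For $d=0$ it is $(\theta,\varphi)\mapsto(\theta,\varphi)$; it is bijective onto $S_{c_0,0}$ if $c\ge0$, and has image $(-\infty,-\sqrt{-c})\times S^1$ if $c<0$ (in which case $(S_{c,0},ds^2_{1,c,0})$ is isometric to the once punctured Lobachevsky plane of curvature $c$). For $d\ne0$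 it is $(\theta,\varphi)\mapsto(\theta/|d|^{1/4},\varphi)$; it is bijective onto $S_{c_0,d_0}$ if $(c,d)\in\Omega_1\cup\ell_4\cup\Omega_4\cup\ell_3$, has image $\bigl((-\infty,-x_3/(-d)^{1/4})\cup(-y_3/(-d)^{1/4},0)\bigr)\times S^1$ if $(c,d)\in\Omega_3$, and has image $(-\infty,-x_3/d^{1/4})\times S^1$ if $d>0$. -/

import Mathlib

open Set Filter Topology
open scoped ContDiff

noncomputable section

namespace Bertrand

/-- The cylinder `ℝ × S¹`, `S¹ = ℝ / 2πℤ`, with coordinates `(x, φ mod 2π)`. -/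
abbrev Cyl : Type := ℝ × Real.Angle

/-- The universal covering `ℝ² → ℝ × S¹`; its local inverses are the charts of the cylinder. -/
def cov (p : ℝ × ℝ) : Cyl := (p.1, (p.2 : Real.Angle))

/-- `f` represents `F` in the charts around the point `cov p`, and is smooth there. -/
def HasSmoothLiftAt (F : Cyl → Cyl) (f : ℝ × ℝ → ℝ × ℝ) (p : ℝ × ℝ) : Prop :=
  ContDiffAt ℝ ∞ f p ∧ ∀ᶠ q in 𝓝 p, F (cov q) = cov (f q)

/-- `F` is `C^∞`-smooth at every point of `U`. -/
def SmoothOn (F : Cyl → Cyl) (U : Set Cyl) : Prop :=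
  ∀ p : ℝ × ℝ, cov p ∈ U → ∃ f, HasSmoothLiftAt F f p

/-- `F` restricts to a `C^∞`-diffeomorphism of the open set `U` onto the open set `V`. -/
def IsDiffeoOn (F : Cyl → Cyl) (U V : Set Cyl) : Prop :=
  IsOpen U ∧ IsOpen V ∧ MapsTo F U V ∧ SmoothOn F U ∧
    ∃ G : Cyl → Cyl, MapsTo G V U ∧ SmoothOn G V ∧ InvOn G F U V

/-- The data of a surface of revolution `dom × S¹` with the metric
`ds² = E(x) dx² + G(x) dφ²`. -/
structure RevSurface where
  dom : Set ℝ
  E : ℝ → ℝ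
  G : ℝ → ℝ

namespace RevSurface

/-- The underlying set `dom × S¹` of the surface. -/
def points (M : RevSurface) : Set Cyl := M.dom ×ˢ univ

/-- The value `ds²(v)` of the metric on a tangent vector `v = (dx, dφ)` at a point over `p`. -/
def metric (M : RevSurface) (p v : ℝ × ℝ) : ℝ := M.E p.1 * v.1 ^ 2 + M.G p.1 * v.2 ^ 2

end RevSurface

/-- The meridian `dom × {φ₀}`. -/
def meridian (M : RevSurface) (φ₀ : Real.Angle) : Set Cyl := M.dom ×ˢ {φ₀}

/-- The parallel `{x₀} × S¹`. -/
def parallel (x₀ : ℝ) : Set Cyl := {x₀} ×ˢ univ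

/-- `F` is a diffeomorphism of the open part `U` of `M` onto the open part `V` of `N` with
`F^* ds²_N = κ² ds²_M`: all lengths are multiplied by `κ`. -/
def IsSimilarityOn (κ : ℝ) (M N : RevSurface) (U V : Set Cyl) (F : Cyl → Cyl) : Prop :=
  U ⊆ M.points ∧ V ⊆ N.points ∧ IsDiffeoOn F U V ∧
    ∀ p : ℝ × ℝ, cov p ∈ U → ∃ f, HasSmoothLiftAt F f p ∧
      ∀ v : ℝ × ℝ, N.metric (f p) (fderiv ℝ f p v) = κ ^ 2 * M.metric p v

/-- `F^* ds²_N = ds²_M`. -/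
def IsIsometryOn (M N : RevSurface) (U V : Set Cyl) (F : Cyl → Cyl) : Prop :=
  IsSimilarityOn 1 M N U V F

/-- Every arc of a meridian of `M` that lies in `U` is carried into a meridian of `N`. -/
def PreservesMeridiansOn (M N : RevSurface) (U : Set Cyl) (F : Cyl → Cyl) : Prop :=
  ∀ (φ : Real.Angle) (a b : ℝ), (Icc a b ×ˢ {φ} : Set Cyl) ⊆ U ∩ meridian M φ →
    ∃ ψ : Real.Angle, F '' (Icc a b ×ˢ {φ}) ⊆ meridian N ψ

/-- Some neighbourhood of `P` in `M` is carried onto a neighbourhood of `P'` in `N` by a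
similarity with coefficient `κ` which takes `P` to `P'` and preserves the family of meridians. -/
def SimilarNear (κ : ℝ) (M N : RevSurface) (P P' : Set Cyl) : Prop :=
  ∃ (U V : Set Cyl) (F : Cyl → Cyl), P ⊆ U ∧ P' ⊆ V ∧ IsSimilarityOn κ M N U V F ∧
    F '' P = P' ∧ PreservesMeridiansOn M N U F

/-- The same for isometries. -/
def IsometricNear (M N : RevSurface) (P P' : Set Cyl) : Prop := SimilarNear 1 M N P P'

/-- Every point of each of the two surfaces has a neighbourhood which is similar, with
coefficient `κ` from `M` to `N` and with preservation of the meridians, to a neighbourhood of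
some point of the other one. -/
def LocallySimilar (κ : ℝ) (M N : RevSurface) : Prop :=
  (∀ p ∈ M.points, ∃ q ∈ N.points, SimilarNear κ M N {p} {q}) ∧
    ∀ q ∈ N.points, ∃ p ∈ M.points, SimilarNear κ M N {p} {q}

/-- Local isometry, with preservation of the meridians. -/
def LocallyIsometric (M N : RevSurface) : Prop := LocallySimilar 1 M N

/-- `u` is a (nonconstant, affinely parametrized) geodesic of `M`, defined on the open
interval `J`: the equations `∇_{u'} u' = 0` for `E(x) dx² + G(x) dφ²`. -/
def IsGeodesicOn (M : RevSurface) (u : ℝ → Cyl) (J : Set ℝ) : Prop :=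
  IsOpen J ∧ J.OrdConnected ∧ J.Nonempty ∧
    ∃ x t : ℝ → ℝ, ContDiffOn ℝ ∞ x J ∧ ContDiffOn ℝ ∞ t J ∧
      ∀ s ∈ J, u s = cov (x s, t s) ∧ x s ∈ M.dom ∧ (deriv x s, deriv t s) ≠ (0, 0) ∧
        deriv (deriv x) s + deriv M.E (x s) / (2 * M.E (x s)) * deriv x s ^ 2
          - deriv M.G (x s) / (2 * M.E (x s)) * deriv t s ^ 2 = 0 ∧
        deriv (deriv t) s + deriv M.G (x s) / M.G (x s) * deriv x s * deriv t s = 0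

/-- `u`, a curve on `J`, is an unparametrized geodesic: it becomes a geodesic after a smooth
regular change of parameter `σ : J' → J`. -/
def IsUnparamGeodesicOn (M : RevSurface) (u : ℝ → Cyl) (J : Set ℝ) : Prop :=
  ∃ (J' : Set ℝ) (σ : ℝ → ℝ), ContDiffOn ℝ ∞ σ J' ∧ BijOn σ J' J ∧
    (∀ s ∈ J', deriv σ s ≠ 0) ∧ IsGeodesicOn M (u ∘ σ) J'

/-- `F` is a projective diffeomorphism of `M` onto an open part of `N`: the unparametrized
geodesics of `M` are exactly the curves that go to unparametrized geodesics of `N`. -/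
def IsProjectiveEmbedding (M N : RevSurface) (F : Cyl → Cyl) : Prop :=
  F '' M.points ⊆ N.points ∧ IsDiffeoOn F M.points (F '' M.points) ∧
    ∀ (u : ℝ → Cyl) (J : Set ℝ), MapsTo u J M.points →
      (IsUnparamGeodesicOn M u J ↔ IsUnparamGeodesicOn N (F ∘ u) J)

/-- `Q_{c,d}(θ) = θ² + c - d θ⁻²`. -/
def Q (c d θ : ℝ) : ℝ := θ ^ 2 + c - d / θ ^ 2

/-- `I_{c,d} = {θ < 0 | Q_{c,d}(θ) > 0, Q_{c,d}'(θ) ≠ 0}`. -/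
def I (c d : ℝ) : Set ℝ := {θ | θ < 0 ∧ 0 < Q c d θ ∧ deriv (Q c d) θ ≠ 0}

/-- The Bertrand surface `S_{c,d} = I_{c,d} × S¹` with
`ds²_{μ,c,d} = dθ² / Q_{c,d}(θ)² + dφ² / (μ² Q_{c,d}(θ))`. -/
def S (μ c d : ℝ) : RevSurface where
  dom := I c d
  E := fun θ => 1 / Q c d θ ^ 2
  G := fun θ => 1 / (μ ^ 2 * Q c d θ)

/-- The Lobachevsky plane of curvature `c < 0` without a point: the punctured Poincaré disc, in
polar coordinates `0 < ρ < 1`, `φ mod 2π`, with `4 (dρ² + ρ² dφ²) / (-c (1 - ρ²)²)`. -/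
def puncturedLobachevsky (c : ℝ) : RevSurface where
  dom := Ioo 0 1
  E := fun ρ => 4 / (-c * (1 - ρ ^ 2) ^ 2)
  G := fun ρ => 4 * ρ ^ 2 / (-c * (1 - ρ ^ 2) ^ 2)

/-- `γ : [0, 2π] → ℝ²` (not necessarily continuous) meets every orbit
`{(l c, l² d) | l > 0}` for exactly one value of the parameter. -/
def IsTransversal (γ : Icc (0 : ℝ) (2 * Real.pi) → ℝ × ℝ) : Prop :=
  ∀ c d : ℝ, ∃! φ, ∃ l : ℝ, 0 < l ∧ γ φ = (l * c, l ^ 2 * d)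

/-- The pair `(lam, φ)` is admissible (`lam > 0`, and `lam = 1` if `γ(φ) = (0,0)`) and
`c = lam² c_φ`, `d = lam⁴ d_φ`, where `γ(φ) = (c_φ, d_φ)`. -/
def IsNormalization (γ : Icc (0 : ℝ) (2 * Real.pi) → ℝ × ℝ) (c d lam : ℝ)
    (φ : Icc (0 : ℝ) (2 * Real.pi)) : Prop :=
  0 < lam ∧ (γ φ = (0, 0) → lam = 1) ∧ c = lam ^ 2 * (γ φ).1 ∧ d = lam ^ 4 * (γ φ).2

/-- `Δ(c,d) = c² + 4d`. -/
def Δ (c d : ℝ) : ℝ := c ^ 2 + 4 * d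

/-- The regions and arcs of the plane of the parameters `(c, d)`. -/
def Ω₁ : Set (ℝ × ℝ) := {p | 0 < Δ p.1 p.2 ∧ p.2 < 0 ∧ 0 < p.1}
def Ω₃ : Set (ℝ × ℝ) := {p | p.1 < 0 ∧ p.2 < 0 ∧ 0 < Δ p.1 p.2}
def Ω₄ : Set (ℝ × ℝ) := {p | Δ p.1 p.2 < 0}
def ℓ₃ : Set (ℝ × ℝ) := {p | p.1 < 0 ∧ Δ p.1 p.2 = 0}
def ℓ₄ : Set (ℝ × ℝ) := {p | 0 < p.1 ∧ Δ p.1 p.2 = 0}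

def x₃ (c d : ℝ) : ℝ := √((-c + √(Δ c d)) / 2)
def y₃ (c d : ℝ) : ℝ := √((-c - √(Δ c d)) / 2)

/-- The lower bound `c₀(c,d)` for the parameter `c₀`. -/
def c₀min (c d : ℝ) : ℝ := if d = 0 then 0 else if d < 0 then -2 else c / √d

/-- `(θ, φ) ↦ (θ / k, φ)`. -/
def rescale (k : ℝ) (p : Cyl) : Cyl := (p.1 / k, p.2)

end Bertrand

end

open Bertrand

namespace Bertrand


/-! Write a meridian-preserving similarity in lifted coordinates. It keeps the angle constant along
meridians and respects orthogonality, so it splits as `(x, t) ↦ (g x, h t)`. The `dφ²` part of the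
metric identity gives `Q₂(g x) = A * Q₁(x)` with `A` constant. The `dθ²` part then gives `|g'| = κ *
A`, so `g` is affine. Comparing coefficients in this rational identity leaves only `g x = x / κ`,
with `c₁ = κ² c₂`, `d₁ = κ⁴ d₂` and `|h'| = μ₂ / μ₁` (`similarity_rigidity`). Near a point `μ` is
therefore invisible. Near a whole parallel the angular map is an injective self-map of the circle
with constant slope `± μ₂ / μ₁`, and such a slope has absolute value 1 (`slope_eq_one`). All the
non-existence claims of (A) and (B) follow, because `κ` is free only on the orbit of the origin.

The existence claims rest on the homogeneity `Q_div`: dividing `θ` by `k` multiplies both metric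
coefficients by `k²`, and an angular slope `μ' / μ` changes `μ` into `μ'`.

For (C), `Q'` does not involve `c`. In the geodesic equations `c` enters only through a multiple of
the velocity, which a change of parameter absorbs (`IsGeodesicOn.exists_rescale`). What remains is
to compare the domains `I c d`, which are found by factoring `θ² Q(θ)` as a quadratic in `θ²`. -/

/-! ### The domain `I c d` and the derivatives of the metric coefficients. -/

lemma hasDerivAt_Q (c d : ℝ) {θ : ℝ} (h : θ ≠ 0) :
    HasDerivAt (Q c d) (2 * θ + 2 * d / θ ^ 3) θ := by
  have h2 : HasDerivAt (fun θ : ℝ => θ ^ 2) (2 * θ) θ := by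
    simpa using hasDerivAt_pow 2 θ
  have := (h2.add_const c).sub (((hasDerivAt_const θ d).div h2 (pow_ne_zero 2 h)))
  refine this.congr_deriv ?_
  field_simp
  ring

lemma deriv_Q (c d : ℝ) {θ : ℝ} (h : θ ≠ 0) : deriv (Q c d) θ = 2 * θ + 2 * d / θ ^ 3 :=
  (hasDerivAt_Q c d h).deriv

/-- Multiplication by `θ²` and by `θ³` clears the denominators of `Q` and `Q'`. All later work on
domains uses this polynomial form. -/
lemma mem_I {c d θ : ℝ} : θ ∈ I c d ↔ θ < 0 ∧ 0 < θ ^ 4 + c * θ ^ 2 - d ∧ θ ^ 4 ≠ -d := by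
  refine and_congr_right fun h => ?_
  have h0 : θ ≠ 0 := h.ne
  have h2 : 0 < θ ^ 2 := by positivity
  have hQ : Q c d θ = (θ ^ 4 + c * θ ^ 2 - d) / θ ^ 2 := by
    unfold Q; field_simp
  have hQ' : 2 * θ + 2 * d / θ ^ 3 = 2 * (θ ^ 4 + d) / θ ^ 3 := by field_simp
  rw [deriv_Q c d h0, hQ, hQ', div_pos_iff_of_pos_right h2]
  refine and_congr_right fun _ => not_congr ?_
  rw [div_eq_zero_iff, or_iff_left (pow_ne_zero 3 h0), mul_eq_zero, or_iff_right two_ne_zero]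
  exact add_eq_zero_iff_eq_neg

lemma isOpen_I (c d : ℝ) : IsOpen (I c d) := by
  have : I c d = {θ | θ < 0} ∩ ({θ | 0 < θ ^ 4 + c * θ ^ 2 - d} ∩ {θ | θ ^ 4 ≠ -d}) := by
    ext θ; exact mem_I
  rw [this]
  refine IsOpen.inter (isOpen_lt (by fun_prop) (by fun_prop)) (IsOpen.inter ?_ ?_)
  · exact isOpen_lt (by fun_prop) (by fun_prop)
  · exact isOpen_ne_fun (by fun_prop) (by fun_prop)

lemma hasDerivAt_S_E (μ : ℝ) {c d θ : ℝ} (h : θ ∈ I c d) :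
    HasDerivAt (S μ c d).E (-2 * (2 * θ + 2 * d / θ ^ 3) / Q c d θ ^ 3) θ := by
  have hQ := h.2.1.ne'
  have := (hasDerivAt_const θ (1 : ℝ)).div ((hasDerivAt_Q c d h.1.ne).pow 2) (pow_ne_zero 2 hQ)
  refine this.congr_deriv ?_
  simp only [Pi.pow_apply]
  generalize 2 * θ + 2 * d / θ ^ 3 = D
  field_simp
  ring

lemma hasDerivAt_S_G {μ : ℝ} (hμ : 0 < μ) {c d θ : ℝ} (h : θ ∈ I c d) :
    HasDerivAt (S μ c d).G (-(2 * θ + 2 * d / θ ^ 3) / (μ ^ 2 * Q c d θ ^ 2)) θ := by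
  have hQ := h.2.1.ne'
  have := (hasDerivAt_const θ (1 : ℝ)).div ((hasDerivAt_Q c d h.1.ne).const_mul (μ ^ 2))
    (mul_ne_zero (pow_ne_zero 2 hμ.ne') hQ)
  refine this.congr_deriv ?_
  generalize 2 * θ + 2 * d / θ ^ 3 = D
  field_simp
  ring

/-! ### Lifts to the universal covering. -/

lemma continuous_cov : Continuous cov :=
  continuous_fst.prodMk (Real.Angle.continuous_coe.comp continuous_snd)

lemma cov_eq_cov_iff {p q : ℝ × ℝ} :
    cov p = cov q ↔ p.1 = q.1 ∧ (p.2 : Real.Angle) = (q.2 : Real.Angle) := Prod.mk_inj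

/-- Two continuous real functions that agree modulo `2π` differ by a locally constant one. -/
lemma eventually_sub_eq_of_coe_eq {X : Type*} [TopologicalSpace X] {g h : X → ℝ} {x : X}
    (hg : ContinuousAt g x) (hh : ContinuousAt h x)
    (he : ∀ᶠ y in 𝓝 x, (g y : Real.Angle) = (h y : Real.Angle)) :
    ∀ᶠ y in 𝓝 x, g y - h y = g x - h x := by
  have hx := he.self_of_nhds
  have hc : ∀ᶠ y in 𝓝 x, |(g y - h y) - (g x - h x)| < 2 * Real.pi := by
    have := (hg.sub hh)
    have := Metric.continuousAt_iff'.1 this (2 * Real.pi) Real.two_pi_pos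
    simpa only [Real.dist_eq, Pi.sub_apply] using this
  filter_upwards [he, hc] with y hy hy'
  -- At `x` and at `y` the difference `g - h` is an integer multiple of `2π`. These integers differ
  -- by less than 1, hence coincide.
  obtain ⟨m, hm⟩ := Real.Angle.angle_eq_iff_two_pi_dvd_sub.1 hy
  obtain ⟨n, hn⟩ := Real.Angle.angle_eq_iff_two_pi_dvd_sub.1 hx
  rw [hm, hn] at hy' ⊢
  rw [← mul_sub, abs_mul, abs_of_pos Real.two_pi_pos] at hy'
  have h1 : |((m - n : ℤ) : ℝ)| < 1 := by
    push_cast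
    exact lt_of_mul_lt_mul_left (by linarith) Real.two_pi_pos.le
  rw [← Int.cast_abs] at h1
  have h2 : |m - n| < 1 := by exact_mod_cast h1
  rw [sub_eq_zero.1 (Int.abs_lt_one_iff.1 h2)]

/-- Two lifts of the same map have the same derivative. -/
lemma fderiv_eq_of_cov_eq {f g : ℝ × ℝ → ℝ × ℝ} {p : ℝ × ℝ} (hf : ContinuousAt f p)
    (hg : ContinuousAt g p) (he : ∀ᶠ q in 𝓝 p, cov (f q) = cov (g q)) :
    fderiv ℝ f p = fderiv ℝ g p := by
  have h2 := eventually_sub_eq_of_coe_eq hf.snd hg.snd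
    (he.mono fun q hq => (cov_eq_cov_iff.1 hq).2)
  have : f =ᶠ[𝓝 p] fun q => g q + (0, (f p).2 - (g p).2) := by
    filter_upwards [he, h2] with q hq hq2
    refine Prod.ext ?_ ?_
    · simpa using (cov_eq_cov_iff.1 hq).1
    · simp only [Prod.snd_add]; linarith
  rw [this.fderiv_eq, fderiv_add_const]

/-! ### Product maps that are affine in the angle. -/

/-- `A` is represented near `t` by an affine function of slope `m`. -/
def HasAffineLiftAt (A : Real.Angle → Real.Angle) (m t : ℝ) : Prop :=
  ∃ b : ℝ, ∀ᶠ s : ℝ in 𝓝 t, A (s : Real.Angle) = ((m * s + b : ℝ) : Real.Angle)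

lemma hasAffineLiftAt_id (t : ℝ) : HasAffineLiftAt id 1 t := ⟨0, by simp⟩

lemma hasSmoothLiftAt_prodMap {g : ℝ → ℝ} {A : Real.Angle → Real.Angle} {m b : ℝ} {p : ℝ × ℝ}
    (hg : ContDiffAt ℝ ∞ g p.1)
    (hA : ∀ᶠ s : ℝ in 𝓝 p.2, A (s : Real.Angle) = ((m * s + b : ℝ) : Real.Angle)) :
    HasSmoothLiftAt (Prod.map g A) (fun q => (g q.1, m * q.2 + b)) p := by
  refine ⟨?_, ?_⟩
  · exact (hg.comp p contDiffAt_fst).prodMk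
      ((contDiffAt_const.mul contDiffAt_snd).add contDiffAt_const)
  · filter_upwards [continuousAt_snd.eventually hA] with q hq
    simp [cov, hq]

lemma smoothOn_prodMap {g : ℝ → ℝ} {A : Real.Angle → Real.Angle} {m : ℝ} {D : Set ℝ}
    {T : Set Real.Angle} (hg : ∀ x ∈ D, ContDiffAt ℝ ∞ g x)
    (hA : ∀ t : ℝ, (t : Real.Angle) ∈ T → HasAffineLiftAt A m t) :
    SmoothOn (Prod.map g A) (D ×ˢ T) := fun p hp =>
  have ⟨_, hb⟩ := hA p.2 hp.2
  ⟨_, hasSmoothLiftAt_prodMap (hg p.1 hp.1) hb⟩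

lemma isDiffeoOn_prodMap {g g' : ℝ → ℝ} {A A' : Real.Angle → Real.Angle} {m m' : ℝ} {D D' : Set ℝ}
    {T T' : Set Real.Angle} (hD : IsOpen D) (hD' : IsOpen D') (hT : IsOpen T) (hT' : IsOpen T')
    (hg : ∀ x ∈ D, ContDiffAt ℝ ∞ g x) (hg' : ∀ x ∈ D', ContDiffAt ℝ ∞ g' x)
    (hgm : MapsTo g D D') (hgm' : MapsTo g' D' D) (hgi : InvOn g' g D D')
    (hA : ∀ t : ℝ, (t : Real.Angle) ∈ T → HasAffineLiftAt A m t)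
    (hA' : ∀ t : ℝ, (t : Real.Angle) ∈ T' → HasAffineLiftAt A' m' t)
    (hAm : MapsTo A T T') (hAm' : MapsTo A' T' T) (hAi : InvOn A' A T T') :
    IsDiffeoOn (Prod.map g A) (D ×ˢ T) (D' ×ˢ T') := by
  refine ⟨hD.prod hT, hD'.prod hT', hgm.prodMap hAm, smoothOn_prodMap hg hA,
    Prod.map g' A', hgm'.prodMap hAm', smoothOn_prodMap hg' hA', ?_, ?_⟩
  · exact fun p hp => Prod.ext (hgi.1 hp.1) (hAi.1 hp.2)
  · exact fun p hp => Prod.ext (hgi.2 hp.1) (hAi.2 hp.2)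

/-- The lift `(g x, m t + b)` has a diagonal differential, so the metric identity reduces to one
scalar equation for `E` and one for `G`. -/
lemma isSimilarityOn_prodMap {M N : RevSurface} {κ : ℝ} {g : ℝ → ℝ}
    {A : Real.Angle → Real.Angle} {m : ℝ} {T T' : Set Real.Angle}
    (hF : IsDiffeoOn (Prod.map g A) (M.dom ×ˢ T) (N.dom ×ˢ T'))
    (hg : ∀ x ∈ M.dom, ContDiffAt ℝ ∞ g x)
    (hA : ∀ t : ℝ, (t : Real.Angle) ∈ T → HasAffineLiftAt A m t)
    (hE : ∀ x ∈ M.dom, N.E (g x) * deriv g x ^ 2 = κ ^ 2 * M.E x)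
    (hG : ∀ x ∈ M.dom, N.G (g x) * m ^ 2 = κ ^ 2 * M.G x) :
    IsSimilarityOn κ M N (M.dom ×ˢ T) (N.dom ×ˢ T') (Prod.map g A) := by
  refine ⟨prod_mono le_rfl (subset_univ _), prod_mono le_rfl (subset_univ _), hF, ?_⟩
  intro p hp
  obtain ⟨b, hb⟩ := hA p.2 hp.2
  refine ⟨_, hasSmoothLiftAt_prodMap (hg p.1 hp.1) hb, fun v => ?_⟩
  have h1 : HasFDerivAt (fun q : ℝ × ℝ => g q.1)
      (deriv g p.1 • ContinuousLinearMap.fst ℝ ℝ ℝ) p :=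
    HasDerivAt.comp_hasFDerivAt p
      ((hg p.1 hp.1).differentiableAt (by simp)).hasDerivAt hasFDerivAt_fst
  have h2 : HasFDerivAt (fun q : ℝ × ℝ => m * q.2 + b) (m • ContinuousLinearMap.snd ℝ ℝ ℝ) p :=
    (hasFDerivAt_snd.const_mul m).add_const b
  rw [(h1.prodMk h2).fderiv]
  have e1 := hE p.1 hp.1
  have e2 := hG p.1 hp.1
  simp only [RevSurface.metric, ContinuousLinearMap.prod_apply, smul_apply,
    ContinuousLinearMap.coe_fst', ContinuousLinearMap.coe_snd', smul_eq_mul]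
  linear_combination v.1 ^ 2 * e1 + v.2 ^ 2 * e2

lemma preservesMeridiansOn_prodMap {M N : RevSurface} {g : ℝ → ℝ}
    {A : Real.Angle → Real.Angle} (U : Set Cyl) (hg : MapsTo g M.dom N.dom) :
    PreservesMeridiansOn M N U (Prod.map g A) := by
  rintro φ a b h
  refine ⟨A φ, ?_⟩
  rintro _ ⟨p, hp, rfl⟩
  exact ⟨hg (h hp).2.1, congrArg A hp.2⟩

/-! ### Stretching arcs of the circle. -/

/-- The arc of angular radius `ε` around `t₀`. -/
def arc (t₀ ε : ℝ) : Set Real.Angle := {φ | ∃ t : ℝ, |t - t₀| < ε ∧ φ = (t : Real.Angle)}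

lemma isOpen_arc (t₀ ε : ℝ) : IsOpen (arc t₀ ε) := by
  have : arc t₀ ε = (fun t : ℝ => (t : Real.Angle)) '' Metric.ball t₀ ε := by
    ext φ
    simp only [arc, mem_ofPred_eq, mem_image, Metric.mem_ball, Real.dist_eq]
    exact exists_congr fun t => and_congr_right fun _ => eq_comm
  rw [this]
  exact QuotientAddGroup.isOpenMap_coe _ Metric.isOpen_ball

lemma center_mem_arc (t₀ : ℝ) {ε : ℝ} (hε : 0 < ε) : (t₀ : Real.Angle) ∈ arc t₀ ε :=
  ⟨t₀, by simpa using hε, rfl⟩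

/-- The map of arcs `t₀ + t ↦ s₀ + m t`. -/
noncomputable def stretch (m t₀ s₀ : ℝ) (φ : Real.Angle) : Real.Angle :=
  ((s₀ + m * (φ - (t₀ : Real.Angle)).toReal : ℝ) : Real.Angle)

/-- `toReal` takes values in `(-π, π]`, so the formula is affine only within distance `π` of `t₀`.
This is the origin of the bounds `ε ≤ π` below. -/
lemma stretch_coe {m t₀ s₀ t : ℝ} (h : |t - t₀| < Real.pi) :
    stretch m t₀ s₀ (t : Real.Angle) = ((s₀ + m * (t - t₀) : ℝ) : Real.Angle) := by
  have := abs_lt.1 h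
  rw [stretch, ← Real.Angle.coe_sub, Real.Angle.toReal_coe_eq_self_iff.2 ⟨this.1, this.2.le⟩]

lemma hasAffineLiftAt_stretch {m t₀ s₀ ε t : ℝ} (hε : ε ≤ Real.pi)
    (ht : (t : Real.Angle) ∈ arc t₀ ε) : HasAffineLiftAt (stretch m t₀ s₀) m t := by
  obtain ⟨r, hr, htr⟩ := ht
  obtain ⟨n, hn⟩ := Real.Angle.angle_eq_iff_two_pi_dvd_sub.1 htr
  refine ⟨s₀ + m * (r - t - t₀), ?_⟩
  have hc : ContinuousAt (fun s : ℝ => |s + (r - t) - t₀|) t := by fun_prop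
  have : ∀ᶠ s in 𝓝 t, |s + (r - t) - t₀| < Real.pi := by
    refine hc.eventually_lt continuousAt_const ?_
    simpa using hr.trans_le hε
  filter_upwards [this] with s hs
  have e : (s : Real.Angle) = ((s + (r - t) : ℝ) : Real.Angle) :=
    Real.Angle.angle_eq_iff_two_pi_dvd_sub.2 ⟨n, by rw [← hn]; ring⟩
  rw [e, stretch_coe hs]
  congr 1
  ring

lemma mapsTo_stretch {m t₀ s₀ ε : ℝ} (hm : 0 < m) (hε : ε ≤ Real.pi) :
    MapsTo (stretch m t₀ s₀) (arc t₀ ε) (arc s₀ (m * ε)) := by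
  rintro _ ⟨t, ht, rfl⟩
  refine ⟨_, ?_, stretch_coe (ht.trans_le hε)⟩
  rw [add_sub_cancel_left, abs_mul, abs_of_pos hm]
  exact mul_lt_mul_of_pos_left ht hm

/-- The second bound `m * ε ≤ π` keeps the image arc from wrapping around the circle and overlapping
itself. -/
lemma leftInvOn_stretch {m t₀ s₀ ε : ℝ} (hm : 0 < m) (hε : ε ≤ Real.pi)
    (hmε : m * ε ≤ Real.pi) :
    LeftInvOn (stretch m⁻¹ s₀ t₀) (stretch m t₀ s₀) (arc t₀ ε) := by
  rintro _ ⟨t, ht, rfl⟩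
  have h : |s₀ + m * (t - t₀) - s₀| < Real.pi := by
    rw [add_sub_cancel_left, abs_mul, abs_of_pos hm]
    exact (mul_lt_mul_of_pos_left ht hm).trans_le hmε
  rw [stretch_coe (ht.trans_le hε), stretch_coe h]
  congr 1
  field_simp
  ring

lemma isDiffeoOn_stretch {g g' : ℝ → ℝ} {D D' : Set ℝ} (hD : IsOpen D) (hD' : IsOpen D')
    (hg : ∀ x ∈ D, ContDiffAt ℝ ∞ g x) (hg' : ∀ x ∈ D', ContDiffAt ℝ ∞ g' x)
    (hgm : MapsTo g D D') (hgm' : MapsTo g' D' D) (hgi : InvOn g' g D D')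
    {m t₀ s₀ ε : ℝ} (hm : 0 < m) (hε : ε ≤ Real.pi) (hmε : m * ε ≤ Real.pi) :
    IsDiffeoOn (Prod.map g (stretch m t₀ s₀)) (D ×ˢ arc t₀ ε) (D' ×ˢ arc s₀ (m * ε)) := by
  have e : m⁻¹ * (m * ε) = ε := by field_simp
  refine isDiffeoOn_prodMap (A' := stretch m⁻¹ s₀ t₀) hD hD' (isOpen_arc _ _) (isOpen_arc _ _)
    hg hg' hgm hgm' hgi (fun t ht => hasAffineLiftAt_stretch hε ht)
    (fun t ht => hasAffineLiftAt_stretch hmε ht) (mapsTo_stretch hm hε) ?_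
    ⟨leftInvOn_stretch hm hε hmε, ?_⟩
  · have := mapsTo_stretch (t₀ := s₀) (s₀ := t₀) (inv_pos.2 hm) hmε
    rwa [e] at this
  · have := leftInvOn_stretch (t₀ := s₀) (s₀ := t₀) (inv_pos.2 hm) hmε (by rwa [e])
    rwa [inv_inv] at this

lemma isDiffeoOn_prodMap_id {g g' : ℝ → ℝ} {D D' : Set ℝ} (hD : IsOpen D) (hD' : IsOpen D')
    (hg : ∀ x ∈ D, ContDiffAt ℝ ∞ g x) (hg' : ∀ x ∈ D', ContDiffAt ℝ ∞ g' x)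
    (hgm : MapsTo g D D') (hgm' : MapsTo g' D' D) (hgi : InvOn g' g D D') :
    IsDiffeoOn (Prod.map g id) (D ×ˢ univ) (D' ×ˢ univ) :=
  isDiffeoOn_prodMap (A' := id) hD hD' isOpen_univ isOpen_univ hg hg' hgm hgm' hgi
    (fun t _ => hasAffineLiftAt_id t) (fun t _ => hasAffineLiftAt_id t) (mapsTo_univ _ _)
    (mapsTo_univ _ _) ⟨fun _ _ => rfl, fun _ _ => rfl⟩

/-! ### Rescalings as similarities of Bertrand surfaces. -/

lemma rescale_eq (k : ℝ) : rescale k = Prod.map (fun x => x / k) id := rfl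

lemma contDiffAt_div_const (k x : ℝ) : ContDiffAt ℝ ∞ (fun x : ℝ => x / k) x :=
  contDiffAt_id.div_const k

lemma Q_div {k : ℝ} (hk : 0 < k) (c d : ℝ) {x : ℝ} (hx : x ≠ 0) :
    Q c d (x / k) = Q (k ^ 2 * c) (k ^ 4 * d) x / k ^ 2 := by
  unfold Q
  field_simp

lemma div_mem_I_iff {k : ℝ} (hk : 0 < k) (c d x : ℝ) :
    x / k ∈ I c d ↔ x ∈ I (k ^ 2 * c) (k ^ 4 * d) := by
  rw [mem_I, mem_I]
  have h4 : 0 < k ^ 4 := by positivity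
  have e1 : (x / k) ^ 4 + c * (x / k) ^ 2 - d =
    (x ^ 4 + k ^ 2 * c * x ^ 2 - k ^ 4 * d) / k ^ 4 := by field_simp
  have e2 : (x / k) ^ 4 ≠ -d ↔ x ^ 4 ≠ -(k ^ 4 * d) := by
    rw [div_pow, ne_eq, div_eq_iff h4.ne']
    simp only [ne_eq, neg_mul, mul_comm]
  rw [e1, e2, div_pos_iff_of_pos_right h4, div_neg_iff]
  simp [hk, not_lt.2 hk.le]

lemma mul_mem_I_iff {k : ℝ} (hk : 0 < k) (c d x : ℝ) :
    k * x ∈ I (k ^ 2 * c) (k ^ 4 * d) ↔ x ∈ I c d := by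
  rw [← div_mem_I_iff hk, mul_div_cancel_left₀ _ hk.ne']

lemma invOn_div {k : ℝ} (hk : 0 < k) (D D' : Set ℝ) :
    InvOn (fun x => k * x) (fun x => x / k) D D' :=
  ⟨fun x _ => mul_div_cancel₀ x hk.ne', fun x _ => mul_div_cancel_left₀ x hk.ne'⟩

lemma S_E_div {μ μ' k : ℝ} (hk : 0 < k) {c d x : ℝ} (hx : x ∈ I (k ^ 2 * c) (k ^ 4 * d)) :
    (S μ' c d).E (x / k) * deriv (fun x : ℝ => x / k) x ^ 2 =
      k ^ 2 * (S μ (k ^ 2 * c) (k ^ 4 * d)).E x := by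
  have hQ := hx.2.1.ne'
  rw [deriv_div_const, deriv_id'']
  simp only [S]
  rw [Q_div hk c d hx.1.ne]
  field_simp

lemma S_G_div {μ μ' k : ℝ} (hμ : 0 < μ) (hμ' : 0 < μ') (hk : 0 < k) {c d x : ℝ}
    (hx : x ∈ I (k ^ 2 * c) (k ^ 4 * d)) :
    (S μ' c d).G (x / k) * (μ' / μ) ^ 2 = k ^ 2 * (S μ (k ^ 2 * c) (k ^ 4 * d)).G x := by
  have hQ := hx.2.1.ne'
  simp only [S]
  rw [Q_div hk c d hx.1.ne]
  field_simp

lemma isSimilarityOn_rescale {μ k : ℝ} (hμ : 0 < μ) (hk : 0 < k) (c d : ℝ) :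
    IsSimilarityOn k (S μ (k ^ 2 * c) (k ^ 4 * d)) (S μ c d)
      (S μ (k ^ 2 * c) (k ^ 4 * d)).points (S μ c d).points (rescale k) := by
  refine isSimilarityOn_prodMap (m := 1) ?_ (fun x _ => contDiffAt_div_const k x)
    (fun t _ => hasAffineLiftAt_id t) (fun x hx => S_E_div hk hx) (fun x hx => ?_)
  · exact isDiffeoOn_prodMap_id (isOpen_I _ _) (isOpen_I _ _)
      (fun x _ => contDiffAt_div_const k x) (fun x _ => contDiffAt_const.mul contDiffAt_id)
      (fun x hx => (div_mem_I_iff hk _ _ _).2 hx) (fun x hx => (mul_mem_I_iff hk _ _ _).2 hx)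
      (invOn_div hk _ _)
  · rw [← S_G_div hμ hμ hk hx, div_self hμ.ne']

/-- Rescaling composed with the change of the angular coordinate that alters `μ`. -/
lemma isSimilarityOn_stretch {μ μ' k : ℝ} (hμ : 0 < μ) (hμ' : 0 < μ') (hk : 0 < k) (c d : ℝ)
    {ε : ℝ} (t₀ s₀ : ℝ) (hε : ε ≤ Real.pi) (hmε : μ' / μ * ε ≤ Real.pi) :
    IsSimilarityOn k (S μ (k ^ 2 * c) (k ^ 4 * d)) (S μ' c d)
      (I (k ^ 2 * c) (k ^ 4 * d) ×ˢ arc t₀ ε) (I c d ×ˢ arc s₀ (μ' / μ * ε))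
      (Prod.map (fun x => x / k) (stretch (μ' / μ) t₀ s₀)) :=
  isSimilarityOn_prodMap (M := S μ (k ^ 2 * c) (k ^ 4 * d)) (N := S μ' c d)
    (isDiffeoOn_stretch (isOpen_I _ _) (isOpen_I _ _)
      (fun _ _ => contDiffAt_div_const k _) (fun _ _ => contDiffAt_const.mul contDiffAt_id)
      (fun _ hx => (div_mem_I_iff hk _ _ _).2 hx) (fun _ hx => (mul_mem_I_iff hk _ _ _).2 hx)
      (invOn_div hk _ _) (div_pos hμ' hμ) hε hmε)
    (fun _ _ => contDiffAt_div_const k _) (fun _ ht => hasAffineLiftAt_stretch hε ht)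
    (fun _ hx => S_E_div hk hx) (fun _ hx => S_G_div hμ hμ' hk hx)

lemma exists_radius {m : ℝ} (hm : 0 < m) :
    ∃ ε : ℝ, 0 < ε ∧ ε ≤ Real.pi ∧ m * ε ≤ Real.pi := by
  refine ⟨min Real.pi (Real.pi / m), lt_min Real.pi_pos (div_pos Real.pi_pos hm),
    min_le_left _ _, ?_⟩
  rw [← le_div_iff₀' hm]
  exact min_le_right _ _

lemma similarNear_points {μ μ' k : ℝ} (hμ : 0 < μ) (hμ' : 0 < μ') (hk : 0 < k) {c d x : ℝ}
    (hx : x ∈ I (k ^ 2 * c) (k ^ 4 * d)) (φ ψ : Real.Angle) :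
    SimilarNear k (S μ (k ^ 2 * c) (k ^ 4 * d)) (S μ' c d) {(x, φ)} {(x / k, ψ)} := by
  induction φ using Real.Angle.induction_on with
  | _ t₀ =>
  induction ψ using Real.Angle.induction_on with
  | _ s₀ =>
  have hm := div_pos hμ' hμ
  obtain ⟨ε, h0, h1, h2⟩ := exists_radius hm
  refine ⟨_, _, _, ?_, ?_, isSimilarityOn_stretch hμ hμ' hk c d t₀ s₀ h1 h2, ?_,
    preservesMeridiansOn_prodMap _ fun x hx => (div_mem_I_iff hk _ _ _).2 hx⟩
  · exact singleton_subset_iff.2 ⟨hx, center_mem_arc _ h0⟩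
  · exact singleton_subset_iff.2
      ⟨(div_mem_I_iff hk _ _ _).2 hx, center_mem_arc _ (mul_pos hm h0)⟩
  · rw [image_singleton, Prod.map_apply, stretch_coe (by simpa using Real.pi_pos)]
    simp

lemma locallySimilar {μ μ' k : ℝ} (hμ : 0 < μ) (hμ' : 0 < μ') (hk : 0 < k) (c d : ℝ) :
    LocallySimilar k (S μ (k ^ 2 * c) (k ^ 4 * d)) (S μ' c d) := by
  refine ⟨fun p hp => ⟨(p.1 / k, p.2), ⟨(div_mem_I_iff hk _ _ _).2 hp.1, mem_univ _⟩,
    similarNear_points hμ hμ' hk hp.1 _ _⟩, fun q hq => ?_⟩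
  have hx := (mul_mem_I_iff hk _ _ _).2 hq.1
  refine ⟨(k * q.1, q.2), ⟨hx, mem_univ _⟩, ?_⟩
  have := similarNear_points hμ hμ' hk hx q.2 q.2
  rwa [mul_div_cancel_left₀ _ hk.ne'] at this

/-- A neighbourhood of a meridian of `S μ c d` embeds into `S 1 c d` by
`(θ, t) ↦ (θ, t / μ)`. -/
lemma exists_isometry_near_meridian {μ : ℝ} (hμ : 0 < μ) (c d t₀ : ℝ) :
    ∃ (U V : Set Cyl) (F : Cyl → Cyl) (ε : ℝ), 0 < ε ∧
      U = {p | p.1 ∈ I c d ∧ ∃ t : ℝ, |t - t₀| < ε ∧ p.2 = (t : Real.Angle)} ∧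
      meridian (S μ c d) (t₀ : Real.Angle) ⊆ U ∧
      IsIsometryOn (S μ c d) (S 1 c d) U V F ∧
      ∀ θ ∈ I c d, ∀ t : ℝ, |t - t₀| < ε →
        F (θ, (t : Real.Angle)) = (θ, ((t / μ : ℝ) : Real.Angle)) := by
  obtain ⟨ε, h0, h1, h2⟩ := exists_radius (div_pos one_pos hμ)
  have h := isSimilarityOn_stretch hμ one_pos one_pos c d t₀ (t₀ / μ) h1 h2
  simp only [one_pow, one_mul] at h
  refine ⟨_, _, _, ε, h0, rfl, ?_, h, fun θ _ t ht => ?_⟩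
  · rintro ⟨x, φ⟩ ⟨hx, rfl⟩
    exact ⟨hx, center_mem_arc _ h0⟩
  · rw [Prod.map_apply, stretch_coe (ht.trans_le h1), div_one]
    congr 2
    ring


/-! ### Splitting of meridian-preserving similarities. -/

lemma HasSmoothLiftAt.continuousAt {F : Cyl → Cyl} {f : ℝ × ℝ → ℝ × ℝ} {p : ℝ × ℝ}
    (h : HasSmoothLiftAt F f p) : ContinuousAt f p := h.1.continuousAt

/-- Near each point a similarity is represented by one map satisfying the metric identity. -/
lemma IsSimilarityOn.exists_lift {κ : ℝ} {M N : RevSurface} {U V : Set Cyl} {F : Cyl → Cyl}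
    (h : IsSimilarityOn κ M N U V F) {p : ℝ × ℝ} (hp : cov p ∈ U) :
    ∃ f : ℝ × ℝ → ℝ × ℝ, ∃ ε > 0, ∀ x t : ℝ, |x - p.1| < ε → |t - p.2| < ε →
      DifferentiableAt ℝ f (x, t) ∧ F (cov (x, t)) = cov (f (x, t)) ∧ cov (x, t) ∈ U ∧
        ∀ v, N.metric (f (x, t)) (fderiv ℝ f (x, t) v) = κ ^ 2 * M.metric (x, t) v := by
  obtain ⟨hU, hV, hF, hmet⟩ := h
  obtain ⟨f, hf, -⟩ := hmet p hp
  have h1 : ∀ᶠ q in 𝓝 p, ContDiffAt ℝ 1 f q :=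
    (hf.1.of_le (by simp)).eventually (by simp)
  have h2 := hf.2.eventually_nhds
  have h3 : ∀ᶠ q in 𝓝 p, cov q ∈ U :=
    continuous_cov.continuousAt.eventually (hF.1.mem_nhds hp)
  obtain ⟨ε, hε, hball⟩ := Metric.eventually_nhds_iff.1 (h1.and (h2.and h3))
  refine ⟨f, ε, hε, fun x t hx ht => ?_⟩
  obtain ⟨hd, he, hm⟩ := hball (y := (x, t))
    (by rw [Prod.dist_eq, Real.dist_eq, Real.dist_eq]; exact max_lt hx ht)
  refine ⟨hd.differentiableAt one_ne_zero, he.self_of_nhds, hm, fun v => ?_⟩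
  -- The lift supplied by the definition may change from point to point. Two lifts have the same
  -- differential, so the identity passes to the fixed lift `f`.
  obtain ⟨g, hg, hgm⟩ := hmet _ hm
  have hfg : ∀ᶠ q in 𝓝 (x, t), cov (f q) = cov (g q) := by
    filter_upwards [he, hg.2] with q h h'
    rw [← h, h']
  have e := hgm v
  rw [← fderiv_eq_of_cov_eq hd.continuousAt hg.continuousAt hfg] at e
  rw [← e]
  simp only [RevSurface.metric, (cov_eq_cov_iff.1 hfg.self_of_nhds).1]

lemma hasDerivAt_fst {f : ℝ → ℝ × ℝ} {v : ℝ × ℝ} {x : ℝ} (h : HasDerivAt f v x) :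
    HasDerivAt (fun y => (f y).1) v.1 x :=
  (ContinuousLinearMap.fst ℝ ℝ ℝ).hasFDerivAt.comp_hasDerivAt x h

lemma hasDerivAt_snd {f : ℝ → ℝ × ℝ} {v : ℝ × ℝ} {x : ℝ} (h : HasDerivAt f v x) :
    HasDerivAt (fun y => (f y).2) v.2 x :=
  (ContinuousLinearMap.snd ℝ ℝ ℝ).hasFDerivAt.comp_hasDerivAt x h

lemma IsSimilarityOn.snd_eq {κ : ℝ} {M N : RevSurface} {U V : Set Cyl} {F : Cyl → Cyl}
    (h : IsSimilarityOn κ M N U V F) (hm : PreservesMeridiansOn M N U F) {x y : ℝ}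
    {φ : Real.Angle} (hU : ∀ z ∈ uIcc x y, (z, φ) ∈ U) : (F (x, φ)).2 = (F (y, φ)).2 := by
  obtain ⟨ψ, hψ⟩ := hm φ (x ⊓ y) (x ⊔ y) (by
    rintro ⟨z, _⟩ ⟨hz, rfl⟩
    exact ⟨hU z hz, (h.1 (hU z hz)).1, rfl⟩)
  have h1 := (hψ (mem_image_of_mem F (mk_mem_prod (left_mem_uIcc (a := x) (b := y)) rfl))).2
  have h2 := (hψ (mem_image_of_mem F (mk_mem_prod (right_mem_uIcc (a := x) (b := y)) rfl))).2
  exact h1.trans h2.symm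

/-- A similarity that preserves meridians splits locally as `(x, t) ↦ (g x, h t)`. -/
lemma IsSimilarityOn.exists_split {κ : ℝ} (hκ : 0 < κ) {M N : RevSurface} {U V : Set Cyl}
    {F : Cyl → Cyl} (hs : IsSimilarityOn κ M N U V F) (hm : PreservesMeridiansOn M N U F)
    (hE : ∀ x ∈ M.dom, 0 < M.E x) {p : ℝ × ℝ} (hp : cov p ∈ U) :
    ∃ (g h g' h' : ℝ → ℝ) (ε : ℝ), 0 < ε ∧
      (∀ x t : ℝ, |x - p.1| < ε → |t - p.2| < ε → x ∈ M.dom ∧ g x ∈ N.dom ∧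
        F (x, (t : Real.Angle)) = (g x, (h t : Real.Angle)) ∧
        N.G (g x) * h' t ^ 2 = κ ^ 2 * M.G x) ∧
      (∀ x : ℝ, |x - p.1| < ε → HasDerivAt g (g' x) x ∧ N.E (g x) * g' x ^ 2 = κ ^ 2 * M.E x) ∧
      ∀ t : ℝ, |t - p.2| < ε → HasDerivAt h (h' t) t := by
  obtain ⟨f, ε, hε, H⟩ := hs.exists_lift hp
  have hp1 : |p.1 - p.1| < ε := by simpa using hε
  have hp2 : |p.2 - p.2| < ε := by simpa using hε
  have hseg : ∀ x y t : ℝ, |x - p.1| < ε → |y - p.1| < ε → |t - p.2| < ε →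
      (F (cov (x, t))).2 = (F (cov (y, t))).2 := by
    intro x y t hx hy ht
    refine hs.snd_eq hm fun z hz => (H z t ?_ ht).2.2.1
    rw [← Real.dist_eq, ← Metric.mem_ball] at hx hy ⊢
    exact (convex_ball p.1 ε).ordConnected.uIcc_subset hx hy hz
  have hsnd : ∀ x y t : ℝ, |x - p.1| < ε → |y - p.1| < ε → |t - p.2| < ε →
      ((f (x, t)).2 : Real.Angle) = ((f (y, t)).2 : Real.Angle) := by
    intro x y t hx hy ht
    have e := hseg x y t hx hy ht
    rw [(H x t hx ht).2.1, (H y t hy ht).2.1] at e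
    exact e
  have hDx : ∀ x t : ℝ, |x - p.1| < ε → |t - p.2| < ε →
      HasDerivAt (fun y => f (y, t)) (fderiv ℝ f (x, t) (1, 0)) x := by
    intro x t hx ht
    have hd := (H x t hx ht).1.hasFDerivAt
    exact hd.comp_hasDerivAt x ((hasDerivAt_id x).prodMk (hasDerivAt_const x t))
  have hDt : ∀ x t : ℝ, |x - p.1| < ε → |t - p.2| < ε →
      HasDerivAt (fun s => f (x, s)) (fderiv ℝ f (x, t) (0, 1)) t := by
    intro x t hx ht
    have hd := (H x t hx ht).1.hasFDerivAt
    exact hd.comp_hasDerivAt t ((hasDerivAt_const t x).prodMk (hasDerivAt_id t))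
  have hnear : ∀ a b : ℝ, |a - b| < ε → ∀ᶠ y in 𝓝 a, |y - b| < ε := fun a b h =>
    (by fun_prop : ContinuousAt (fun y : ℝ => |y - b|) a).eventually_lt continuousAt_const h
  -- The angle of the image is constant modulo `2π` along a meridian, hence its continuous lift is
  -- locally constant.
  have hDx2 : ∀ x t : ℝ, |x - p.1| < ε → |t - p.2| < ε → (fderiv ℝ f (x, t) (1, 0)).2 = 0 := by
    intro x t hx ht
    have h1 := hasDerivAt_snd (hDx x t hx ht)
    have h2 := eventually_sub_eq_of_coe_eq (g := fun y => (f (y, t)).2)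
      (h := fun _ => (f (x, t)).2) h1.continuousAt continuousAt_const
      ((hnear x p.1 hx).mono fun y hy => hsnd y x t hy hx ht)
    refine h1.unique ((hasDerivAt_const x (f (x, t)).2).congr_of_eventuallyEq ?_)
    filter_upwards [h2] with y hy
    linarith
  have hdom : ∀ x t : ℝ, |x - p.1| < ε → |t - p.2| < ε → x ∈ M.dom ∧ (f (x, t)).1 ∈ N.dom := by
    intro x t hx ht
    obtain ⟨-, e, hU, -⟩ := H x t hx ht
    refine ⟨(hs.1 hU).1, ?_⟩
    have := (hs.2.1 (hs.2.2.1.2.2.1 hU)).1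
    rwa [e] at this
  have hmet : ∀ x t : ℝ, |x - p.1| < ε → |t - p.2| < ε →
      N.E (f (x, t)).1 * (fderiv ℝ f (x, t) (1, 0)).1 ^ 2 = κ ^ 2 * M.E x ∧
      (fderiv ℝ f (x, t) (0, 1)).1 = 0 ∧
      N.G (f (x, t)).1 * (fderiv ℝ f (x, t) (0, 1)).2 ^ 2 = κ ^ 2 * M.G x := by
    intro x t hx ht
    have hz := hDx2 x t hx ht
    obtain ⟨hxM, hxN⟩ := hdom x t hx ht
    have hM := (H x t hx ht).2.2.2
    have e1 := hM (1, 0)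
    have e2 := hM (0, 1)
    -- Polarization: evaluating on the sum of the basis vectors makes their images orthogonal. The
    -- image of `(1, 0)` is a nonzero horizontal vector, so that of `(0, 1)` is vertical.
    have e3 := hM ((1, 0) + (0, 1))
    rw [map_add] at e3
    generalize fderiv ℝ f (x, t) (1, 0) = a at *
    generalize fderiv ℝ f (x, t) (0, 1) = b at *
    obtain ⟨a1, a2⟩ := a
    obtain ⟨b1, b2⟩ := b
    obtain rfl : a2 = 0 := hz
    simp only [RevSurface.metric, Prod.mk_add_mk] at e1 e2 e3
    have hne : N.E (f (x, t)).1 * a1 ≠ 0 := by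
      intro h0
      have h1 : κ ^ 2 * M.E x = 0 := by linear_combination -e1 + a1 * h0
      exact (mul_pos (pow_pos hκ 2) (hE x hxM)).ne' h1
    have hb : b1 = 0 := by
      have : N.E (f (x, t)).1 * a1 * b1 = 0 := by linear_combination (e3 - e1 - e2) / 2
      exact (mul_eq_zero.1 this).resolve_left hne
    subst hb
    exact ⟨by linear_combination e1, rfl, by linear_combination e2⟩
  have hfst : ∀ x t : ℝ, |x - p.1| < ε → |t - p.2| < ε → (f (x, t)).1 = (f (x, p.2)).1 := by
    intro x t hx ht
    have hO : {s | |s - p.2| < ε} = Metric.ball p.2 ε := by ext s; simp [Real.dist_eq]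
    refine IsOpen.is_const_of_deriv_eq_zero (s := {s | |s - p.2| < ε})
      (f := fun s => (f (x, s)).1) (hO ▸ Metric.isOpen_ball)
      (hO ▸ (convex_ball p.2 ε).isPreconnected)
      (fun s hs => (hasDerivAt_fst (hDt x s hx hs)).differentiableAt.differentiableWithinAt)
      (fun s hs => ?_) ht hp2
    rw [(hasDerivAt_fst (hDt x s hx hs)).deriv]
    exact (hmet x s hx hs).2.1
  refine ⟨fun x => (f (x, p.2)).1, fun t => (f (p.1, t)).2,
    fun x => (fderiv ℝ f (x, p.2) (1, 0)).1, fun t => (fderiv ℝ f (p.1, t) (0, 1)).2, ε, hε,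
    fun x t hx ht => ⟨(hdom x t hx ht).1, (hdom x p.2 hx hp2).2, ?_, ?_⟩,
    fun x hx => ⟨hasDerivAt_fst (hDx x p.2 hx hp2), (hmet x p.2 hx hp2).1⟩,
    fun t ht => hasDerivAt_snd (hDt p.1 t hp1 ht)⟩
  · refine (H x t hx ht).2.1.trans (Prod.ext (hfst x t hx ht) (hsnd x p.1 t hx hp1 ht))
  -- The two angular lifts over `x` and `p.1` differ by a locally constant function of `t`, so their
  -- `t`-derivatives agree and `h'` serves every `x`.
  · have h1 := hasDerivAt_snd (hDt x t hx ht)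
    have h2 := hasDerivAt_snd (hDt p.1 t hp1 ht)
    have h3 := eventually_sub_eq_of_coe_eq h1.continuousAt h2.continuousAt
      ((hnear t p.2 ht).mono fun s hs => hsnd x p.1 s hx hp1 hs)
    have h4 : (fderiv ℝ f (x, t) (0, 1)).2 - (fderiv ℝ f (p.1, t) (0, 1)).2 = 0 :=
      (h1.sub h2).unique ((hasDerivAt_const t _).congr_of_eventuallyEq h3)
    have := (hmet x t hx ht).2.2
    rw [hfst x t hx ht, sub_eq_zero.1 h4] at this
    exact this

/-! ### Rigidity of similarities. -/

/-- A function whose derivative has constant absolute value on an interval is affine there. -/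
lemma exists_affine {g g' : ℝ → ℝ} {a ε B : ℝ} (hε : 0 < ε) (hB : 0 < B)
    (hg : ∀ x, |x - a| < ε → HasDerivAt g (g' x) x) (hg' : ∀ x, |x - a| < ε → g' x ^ 2 = B ^ 2) :
    ∃ m b : ℝ, (m = B ∨ m = -B) ∧ ∀ x, |x - a| < ε → g x = m * x + b := by
  have hO : {x | |x - a| < ε} = Metric.ball a ε := by ext s; simp [Real.dist_eq]
  have ha : |a - a| < ε := by simpa using hε
  have hconst : ∃ m, (m = B ∨ m = -B) ∧ ∀ x, |x - a| < ε → g' x = m := by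
    -- By Darboux's theorem a derivative that never vanishes has constant sign; continuity of `g'`
    -- is not needed.
    rcases hasDerivWithinAt_forall_lt_or_forall_gt_of_forall_ne (s := {x | |x - a| < ε}) (m := 0)
      (hO ▸ convex_ball a ε) (fun x hx => (hg x hx).hasDerivWithinAt)
      (fun x hx h0 => by
        have := hg' x hx
        rw [h0] at this
        nlinarith [pow_pos hB 2]) with h | h
    · refine ⟨-B, Or.inr rfl, fun x hx => (sq_eq_sq_iff_eq_or_eq_neg.1 (hg' x hx)).resolve_left ?_⟩
      intro e
      have := h x hx
      linarith
    · refine ⟨B, Or.inl rfl, fun x hx => (sq_eq_sq_iff_eq_or_eq_neg.1 (hg' x hx)).resolve_right ?_⟩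
      intro e
      have := h x hx
      linarith
  obtain ⟨m, hm, hgm⟩ := hconst
  refine ⟨m, g a - m * a, hm, fun x hx => ?_⟩
  have hD : ∀ x, |x - a| < ε → HasDerivAt (fun x => g x - m * x) 0 x := fun x hx =>
    ((hg x hx).sub ((hasDerivAt_id x).const_mul m)).congr_deriv (by rw [hgm x hx]; ring)
  have := IsOpen.is_const_of_deriv_eq_zero (s := {x | |x - a| < ε})
      (f := fun x => g x - m * x) (hO ▸ Metric.isOpen_ball)
      (hO ▸ (convex_ball a ε).isPreconnected)
      (fun s hs => (hD s hs).differentiableAt.differentiableWithinAt)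
      (fun s hs => (hD s hs).deriv) hx ha
  linarith

open Polynomial in
lemma coeff_eq_zero_of_sextic {a₀ a₁ a₂ a₃ a₄ a₅ a₆ a ε : ℝ} (hε : 0 < ε)
    (h : ∀ x : ℝ, |x - a| < ε →
      a₀ + a₁ * x + a₂ * x ^ 2 + a₃ * x ^ 3 + a₄ * x ^ 4 + a₅ * x ^ 5 + a₆ * x ^ 6 = 0) :
    a₀ = 0 ∧ a₁ = 0 ∧ a₂ = 0 ∧ a₃ = 0 ∧ a₄ = 0 ∧ a₅ = 0 ∧ a₆ = 0 := by
  set P : ℝ[X] := C a₀ + C a₁ * X + C a₂ * X ^ 2 + C a₃ * X ^ 3 + C a₄ * X ^ 4 + C a₅ * X ^ 5 +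
    C a₆ * X ^ 6 with hP
  have h0 : P = 0 := by
    refine eq_zero_of_infinite_isRoot P (Set.Infinite.mono (s := Ioo (a - ε) (a + ε)) ?_ ?_)
    · intro x hx
      have := h x (abs_lt.2 ⟨by linarith [hx.1], by linarith [hx.2]⟩)
      simpa [hP, IsRoot] using this
    · exact Ioo_infinite (by linarith)
  have hc : ∀ n, P.coeff n = 0 := fun n => by rw [h0, coeff_zero]
  have e0 := hc 0
  have e1 := hc 1
  have e2 := hc 2
  have e3 := hc 3
  have e4 := hc 4
  have e5 := hc 5
  have e6 := hc 6
  simp [hP, coeff_X, coeff_C, coeff_X_pow] at e0 e1 e2 e3 e4 e5 e6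
  exact ⟨e0, e1, e2, e3, e4, e5, e6⟩

/-- Clearing the denominators `x²` and `(B x + b)²` gives a sextic that vanishes on an interval. Its
coefficient of `x⁶` gives `A = B²`, then `x⁵` gives `b = 0`, `x⁴` relates `c₁` and `c₂`, and `x²`
relates `d₁` and `d₂`. -/
lemma affine_rigidity {A B b a ε c₁ d₁ c₂ d₂ : ℝ} (hε : 0 < ε) (hB : B ≠ 0)
    (h : ∀ x : ℝ, |x - a| < ε →
      x ≠ 0 ∧ B * x + b ≠ 0 ∧ Q c₂ d₂ (B * x + b) = A * Q c₁ d₁ x) :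
    b = 0 ∧ A = B ^ 2 ∧ c₂ = B ^ 2 * c₁ ∧ d₂ = B ^ 4 * d₁ := by
  have key := coeff_eq_zero_of_sextic (a := a)
    (a₀ := A * d₁ * b ^ 2) (a₁ := 2 * A * d₁ * B * b)
    (a₂ := b ^ 4 + c₂ * b ^ 2 - d₂ + A * d₁ * B ^ 2 - A * c₁ * b ^ 2)
    (a₃ := 4 * B * b ^ 3 + 2 * c₂ * B * b - 2 * A * c₁ * B * b)
    (a₄ := 6 * B ^ 2 * b ^ 2 + c₂ * B ^ 2 - A * b ^ 2 - A * c₁ * B ^ 2)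
    (a₅ := 4 * B ^ 3 * b - 2 * A * B * b) (a₆ := B ^ 4 - A * B ^ 2) hε (fun x hx => by
      obtain ⟨hx0, hy0, e⟩ := h x hx
      unfold Q at e
      have e1 : (B * x + b) ^ 2 * ((B * x + b) ^ 2 + c₂ - d₂ / (B * x + b) ^ 2) =
        (B * x + b) ^ 4 + c₂ * (B * x + b) ^ 2 - d₂ := by field_simp
      have e2 : x ^ 2 * (x ^ 2 + c₁ - d₁ / x ^ 2) = x ^ 4 + c₁ * x ^ 2 - d₁ := by field_simp
      linear_combination -x ^ 2 * e1 + A * (B * x + b) ^ 2 * e2 + x ^ 2 * (B * x + b) ^ 2 * e)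
  obtain ⟨-, -, k2, -, k4, k5, k6⟩ := key
  have hA : A = B ^ 2 := by
    have : B ^ 2 * (B ^ 2 - A) = 0 := by linear_combination k6
    linarith [(mul_eq_zero.1 this).resolve_left (pow_ne_zero 2 hB)]
  subst hA
  have hb : b = 0 := by
    have : B ^ 3 * b = 0 := by linear_combination k5 / 2
    exact (mul_eq_zero.1 this).resolve_left (pow_ne_zero 3 hB)
  subst hb
  refine ⟨rfl, rfl, ?_, by linear_combination -k2⟩
  have : B ^ 2 * (c₂ - B ^ 2 * c₁) = 0 := by linear_combination k4
  linarith [(mul_eq_zero.1 this).resolve_left (pow_ne_zero 2 hB)]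

lemma S_E_pos (μ : ℝ) {c d x : ℝ} (hx : x ∈ I c d) : 0 < (S μ c d).E x :=
  one_div_pos.2 (pow_pos hx.2.1 2)

/-- A similarity of Bertrand surfaces that preserves meridians is locally the rescaling by its
coefficient, with an affine change of the angular coordinate of slope `± μ₂ / μ₁`. -/
lemma similarity_rigidity {κ μ₁ μ₂ c₁ d₁ c₂ d₂ : ℝ} (hκ : 0 < κ) (hμ₁ : 0 < μ₁) (hμ₂ : 0 < μ₂)
    {U V : Set Cyl} {F : Cyl → Cyl} (hs : IsSimilarityOn κ (S μ₁ c₁ d₁) (S μ₂ c₂ d₂) U V F)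
    (hm : PreservesMeridiansOn (S μ₁ c₁ d₁) (S μ₂ c₂ d₂) U F) {x t : ℝ}
    (hp : (x, (t : Real.Angle)) ∈ U) :
    c₁ = κ ^ 2 * c₂ ∧ d₁ = κ ^ 4 * d₂ ∧ (F (x, (t : Real.Angle))).1 = x / κ ∧
      (HasAffineLiftAt (fun φ => (F (x, φ)).2) (μ₂ / μ₁) t ∨
        HasAffineLiftAt (fun φ => (F (x, φ)).2) (-(μ₂ / μ₁)) t) := by
  obtain ⟨g, h, g', h', ε, hε, H, Hg, Hh⟩ := hs.exists_split (p := (x, t)) hκ hm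
    (fun y hy => S_E_pos μ₁ hy) hp
  simp only at H Hg Hh
  have hx : |x - x| < ε := by simpa using hε
  have ht : |t - t| < ε := by simpa using hε
  -- This is the ratio `Q₂(g y) / Q₁(y)` read off from the `G`-identity. With `t` frozen it does not
  -- depend on `y`.
  set A := (h' t * μ₁ / (κ * μ₂)) ^ 2 with hA
  have hQ : ∀ y, |y - x| < ε → 0 < Q c₁ d₁ y ∧ 0 < Q c₂ d₂ (g y) := fun y hy =>
    ⟨(H y t hy ht).1.2.1, (H y t hy ht).2.1.2.1⟩
  have hAQ : ∀ y, |y - x| < ε → Q c₂ d₂ (g y) = A * Q c₁ d₁ y := by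
    intro y hy
    obtain ⟨q1, q2⟩ := hQ y hy
    have e := (H y t hy ht).2.2.2
    simp only [S] at e
    rw [hA]
    field_simp at e ⊢
    linear_combination -e
  have hA0 : 0 < A := by
    obtain ⟨q1, q2⟩ := hQ x hx
    rw [hAQ x hx] at q2
    exact pos_of_mul_pos_left q2 q1.le
  have hg' : ∀ y, |y - x| < ε → g' y ^ 2 = (κ * A) ^ 2 := by
    intro y hy
    obtain ⟨q1, q2⟩ := hQ y hy
    have e := (Hg y hy).2
    simp only [S] at e
    rw [hAQ y hy] at e
    field_simp at e
    linear_combination e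
  obtain ⟨B, b, hB, hgB⟩ := exists_affine hε (mul_pos hκ hA0) (fun y hy => (Hg y hy).1) hg'
  have hB0 : B ≠ 0 := by
    rcases hB with rfl | rfl
    · exact (mul_pos hκ hA0).ne'
    · exact neg_ne_zero.2 (mul_pos hκ hA0).ne'
  obtain ⟨rfl, hAB, hc, hd⟩ := affine_rigidity (a := x) (A := A) (b := b) (c₁ := c₁) (d₁ := d₁)
    (c₂ := c₂) (d₂ := d₂) hε hB0 (fun y hy => by
      rw [← hgB y hy]
      exact ⟨(H y t hy ht).1.1.ne, (H y t hy ht).2.1.1.ne, hAQ y hy⟩)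
  have hxneg : x < 0 := (H x t hx ht).1.1
  -- Both `x` and its image `B x` are negative.
  have hBpos : 0 < B := by
    have h2 : g x < 0 := (H x t hx ht).2.1.1
    rw [hgB x hx, add_zero] at h2
    by_contra hle
    nlinarith
  -- The sign is now known, so `B = κ A = κ B²`.
  have hBκ : B * κ = 1 := by
    have : B = κ * A := hB.resolve_right fun e => by
      have := mul_pos hκ hA0
      linarith
    rw [hAB] at this
    have : B * (B * κ - 1) = 0 := by linear_combination -this
    linarith [(mul_eq_zero.1 this).resolve_left hB0]
  have hB' : B = 1 / κ := by field_simp; exact hBκ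
  have hA1 : A * κ ^ 2 = 1 := by rw [hAB]; linear_combination (B * κ + 1) * hBκ
  refine ⟨?_, ?_, ?_, ?_⟩
  · rw [hc, hB']; field_simp
  · rw [hd, hB']; field_simp
  · rw [(H x t hx ht).2.2.1, hgB x hx, hB']; simp; ring
  · have hh' : ∀ s, |s - t| < ε → h' s ^ 2 = (μ₂ / μ₁) ^ 2 := by
      intro s hs'
      obtain ⟨q1, q2⟩ := hQ x hx
      have e := (H x s hx hs').2.2.2
      simp only [S] at e
      rw [hAQ x hx] at e
      field_simp at e ⊢
      linear_combination e + μ₂ ^ 2 * hA1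
    obtain ⟨m, b', hmm, hhm⟩ := exists_affine hε (div_pos hμ₂ hμ₁) Hh hh'
    have hl : HasAffineLiftAt (fun φ => (F (x, φ)).2) m t := by
      refine ⟨b', ?_⟩
      have hc : ContinuousAt (fun s : ℝ => |s - t|) t := by fun_prop
      filter_upwards [hc.eventually_lt continuousAt_const ht] with s hs'
      rw [(H x s hx hs').2.2.1, hhm s hs']
    rcases hmm with rfl | rfl
    · exact Or.inl hl
    · exact Or.inr hl

/-! ### Slopes of circle maps, and the parameters recovered from a similarity. -/

lemma HasAffineLiftAt.eventually {A : Real.Angle → Real.Angle} {m t : ℝ}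
    (h : HasAffineLiftAt A m t) : ∀ᶠ s : ℝ in 𝓝 t, HasAffineLiftAt A m s :=
  have ⟨b, hb⟩ := h
  hb.eventually_nhds.mono fun _ hs => ⟨b, hs⟩

lemma HasAffineLiftAt.slope_eq {A : Real.Angle → Real.Angle} {m m' t : ℝ}
    (h : HasAffineLiftAt A m t) (h' : HasAffineLiftAt A m' t) : m = m' := by
  obtain ⟨b, hb⟩ := h
  obtain ⟨b', hb'⟩ := h'
  have e := eventually_sub_eq_of_coe_eq (g := fun s => m * s + b) (h := fun s => m' * s + b')
    (x := t) (by fun_prop) (by fun_prop) (by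
      filter_upwards [hb, hb'] with s h h'
      rw [← h, h'])
  have hd : ∀ m b : ℝ, HasDerivAt (fun s => m * s + b) m t := fun m b =>
    (((hasDerivAt_id t).const_mul m).add_const b).congr_deriv (mul_one m)
  have : m - m' = 0 := ((hd m b).sub (hd m' b')).unique
    ((hasDerivAt_const t _).congr_of_eventuallyEq e)
  linarith

lemma eq_add_of_hasAffineLiftAt {A : Real.Angle → Real.Angle} {m : ℝ}
    (h : ∀ t, HasAffineLiftAt A m t) (t : ℝ) :
    A (t : Real.Angle) = A 0 + ((m * t : ℝ) : Real.Angle) := by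
  have hl : IsLocallyConstant fun t : ℝ => A (t : Real.Angle) - ((m * t : ℝ) : Real.Angle) := by
    rw [IsLocallyConstant.iff_eventually_eq]
    intro t
    obtain ⟨b, hb⟩ := h t
    filter_upwards [hb] with s hs
    rw [hs, hb.self_of_nhds, Real.Angle.coe_add, Real.Angle.coe_add, add_sub_cancel_left,
      add_sub_cancel_left]
  have := hl.apply_eq_of_preconnectedSpace t 0
  simp only [mul_zero, Real.Angle.coe_zero, sub_zero] at this
  rw [← this, sub_add_cancel]

lemma exists_int_of_coe_two_pi_mul_eq_zero {x : ℝ}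
    (h : ((2 * Real.pi * x : ℝ) : Real.Angle) = 0) : ∃ n : ℤ, x = n := by
  rw [← Real.Angle.coe_zero, Real.Angle.angle_eq_iff_two_pi_dvd_sub] at h
  obtain ⟨n, hn⟩ := h
  refine ⟨n, ?_⟩
  rw [sub_zero] at hn
  exact mul_left_cancel₀ Real.two_pi_pos.ne' hn

/-- An injective self-map of the circle that is locally affine with slopes `± K` has `K = 1`. -/
lemma slope_eq_one {A : Real.Angle → Real.Angle} (hA : Function.Injective A) {K : ℝ} (hK : 0 < K)
    (h : ∀ t, HasAffineLiftAt A K t ∨ HasAffineLiftAt A (-K) t) : K = 1 := by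
  -- The sets of points with slope `K` and with slope `-K` are open, disjoint and cover `ℝ`;
  -- connectedness selects one sign.
  have hm : ∃ m, |m| = K ∧ ∀ t, HasAffineLiftAt A m t := by
    have ho : ∀ m, IsOpen {t | HasAffineLiftAt A m t} := fun m =>
      isOpen_iff_mem_nhds.2 fun t ht => HasAffineLiftAt.eventually ht
    have hdis : Disjoint {t | HasAffineLiftAt A K t} {t | HasAffineLiftAt A (-K) t} := by
      refine Set.disjoint_left.2 fun t h1 h2 => ?_
      have := HasAffineLiftAt.slope_eq h1 h2
      linarith
    rcases isPreconnected_univ.subset_or_subset (ho K) (ho (-K)) hdis (fun t _ => h t) with h | h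
    · exact ⟨K, abs_of_pos hK, fun t => h (mem_univ t)⟩
    · exact ⟨-K, by rw [abs_neg, abs_of_pos hK], fun t => h (mem_univ t)⟩
  obtain ⟨m, rfl, hm⟩ := hm
  have hm0 : m ≠ 0 := abs_pos.1 hK
  have heq := eq_add_of_hasAffineLiftAt hm
  -- `A` takes the same value at `0` and `2π`, which makes `m` an integer.
  obtain ⟨n, hn⟩ : ∃ n : ℤ, m = n := by
    apply exists_int_of_coe_two_pi_mul_eq_zero
    have := heq (2 * Real.pi)
    rw [Real.Angle.coe_two_pi] at this
    rw [mul_comm]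
    exact left_eq_add.1 this
  -- `A` also takes the same value at `0` and `2π / m`, so injectivity makes `1 / m` an integer.
  obtain ⟨k, hk⟩ : ∃ k : ℤ, 1 / m = k := by
    apply exists_int_of_coe_two_pi_mul_eq_zero
    apply hA
    rw [heq, show m * (2 * Real.pi * (1 / m)) = 2 * Real.pi by field_simp, Real.Angle.coe_two_pi,
      add_zero]
  have hnk : n * k = 1 := by
    have : m * (1 / m) = 1 := by field_simp
    rw [hk, hn] at this
    exact_mod_cast this
  rw [hn]
  rcases Int.eq_one_or_neg_one_of_mul_eq_one hnk with rfl | rfl <;> simp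

lemma SimilarNear.eq_of_points {κ μ₁ μ₂ c₁ d₁ θ₁ c₂ d₂ θ₂ : ℝ} (hκ : 0 < κ) (hμ₁ : 0 < μ₁)
    (hμ₂ : 0 < μ₂)
    (h : SimilarNear κ (S μ₁ c₁ d₁) (S μ₂ c₂ d₂) {(θ₁, 0)} {(θ₂, 0)}) :
    c₁ = κ ^ 2 * c₂ ∧ d₁ = κ ^ 4 * d₂ ∧ θ₂ = θ₁ / κ := by
  obtain ⟨U, V, F, hU, -, hs, hF, hm⟩ := h
  rw [← Real.Angle.coe_zero] at hU
  obtain ⟨hc, hd, hθ, -⟩ := similarity_rigidity hκ hμ₁ hμ₂ hs hm (hU rfl)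
  rw [image_singleton, singleton_eq_singleton_iff] at hF
  refine ⟨hc, hd, ?_⟩
  rw [← hθ, Real.Angle.coe_zero, hF]

lemma SimilarNear.eq_of_parallels {κ μ₁ μ₂ c₁ d₁ θ₁ c₂ d₂ θ₂ : ℝ} (hκ : 0 < κ) (hμ₁ : 0 < μ₁)
    (hμ₂ : 0 < μ₂)
    (h : SimilarNear κ (S μ₁ c₁ d₁) (S μ₂ c₂ d₂) (parallel θ₁) (parallel θ₂)) :
    μ₁ = μ₂ ∧ c₁ = κ ^ 2 * c₂ ∧ d₁ = κ ^ 4 * d₂ ∧ θ₂ = θ₁ / κ := by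
  obtain ⟨U, V, F, hU, -, hs, hF, hm⟩ := h
  have hU' : ∀ φ, (θ₁, φ) ∈ U := fun φ => hU ⟨rfl, mem_univ φ⟩
  have hF' : ∀ φ, (F (θ₁, φ)).1 = θ₂ := fun φ =>
    ((Set.ext_iff.1 hF _).1 (mem_image_of_mem F (mk_mem_prod rfl (mem_univ φ)))).1
  have key := fun t : ℝ => similarity_rigidity hκ hμ₁ hμ₂ hs hm (hU' t)
  obtain ⟨hc, hd, hθ, -⟩ := key 0
  refine ⟨?_, hc, hd, by rw [← hθ, hF']⟩
  -- Here the whole circle is used: `F` is injective on the parallel and its image has constant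
  -- first coordinate, so the angular part is injective.
  obtain ⟨-, -, -, -, G, -, -, hG, -⟩ := hs.2.2.1
  have hinj : Function.Injective fun φ => (F (θ₁, φ)).2 := by
    intro φ ψ hφψ
    have e : F (θ₁, φ) = F (θ₁, ψ) := Prod.ext ((hF' φ).trans (hF' ψ).symm) hφψ
    have := congrArg G e
    rw [hG (hU' φ), hG (hU' ψ)] at this
    exact congrArg Prod.snd this
  have := slope_eq_one hinj (div_pos hμ₂ hμ₁) fun t => (key t).2.2.2
  exact ((div_eq_one_iff_eq hμ₁.ne').1 this).symm


/-! ### Geodesics and projective equivalence. -/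

/-- A change of parameter with prescribed positive speed. -/
lemma exists_reparametrization {J : Set ℝ} (hJ : IsOpen J) (hJc : J.OrdConnected)
    (hJn : J.Nonempty) {w : ℝ → ℝ} (hw : ContDiffOn ℝ ∞ w J) (hpos : ∀ s ∈ J, 0 < w s) :
    ∃ (J' : Set ℝ) (σ : ℝ → ℝ), IsOpen J' ∧ J'.OrdConnected ∧ J'.Nonempty ∧
      ContDiffOn ℝ ∞ σ J' ∧ BijOn σ J' J ∧ ∀ s ∈ J', HasDerivAt σ (w (σ s))⁻¹ s := by
  obtain ⟨s₀, hs₀⟩ := hJn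
  set τ : ℝ → ℝ := fun s => ∫ r in s₀..s, w r with hτ
  -- `σ` is the inverse of the primitive `τ` of `w`, which is smooth and strictly increasing.
  have hτd : ∀ s ∈ J, HasDerivAt τ (w s) s := by
    intro s hs
    refine intervalIntegral.integral_hasDerivAt_right ?_ ?_ ?_
    · exact (hw.continuousOn.mono (hJc.uIcc_subset hs₀ hs)).intervalIntegrable
    · exact hw.continuousOn.stronglyMeasurableAtFilter hJ s hs
    · exact hw.continuousOn.continuousAt (hJ.mem_nhds hs)
  have hτs : ContDiffOn ℝ ∞ τ J := by
    rw [contDiffOn_infty_iff_deriv_of_isOpen hJ]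
    refine ⟨fun s hs => (hτd s hs).differentiableAt.differentiableWithinAt, ?_⟩
    exact hw.congr fun s hs => (hτd s hs).deriv
  have hmono : StrictMonoOn τ J := by
    refine strictMonoOn_of_deriv_pos hJc.convex hτs.continuousOn fun s hs => ?_
    rw [hJ.interior_eq] at hs
    rw [(hτd s hs).deriv]
    exact hpos s hs
  have hopen : IsOpenMap (J.domRestrict τ) := by
    rw [isOpenMap_iff_nhds_le]
    rintro ⟨s, hs⟩
    have hst : HasStrictDerivAt τ (w s) s :=
      (hτs.contDiffAt (hJ.mem_nhds hs)).hasStrictDerivAt' (hτd s hs) (by simp)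
    have e := hst.map_nhds_eq (hpos s hs).ne'
    have : J.domRestrict τ = τ ∘ Subtype.val := rfl
    rw [this, ← Filter.map_map, map_nhds_subtype_coe_eq_nhds hs (hJ.mem_nhds hs), e]
    rfl
  let e := OpenPartialHomeomorph.ofContinuousOpenRestrict hmono.injOn.toPartialEquiv
    hτs.continuousOn hopen hJ
  have hsrc : e.source = J := rfl
  have htgt : e.target = τ '' J := rfl
  have hmem : ∀ s ∈ τ '' J, e.symm s ∈ J := fun s hs => e.map_target hs
  have hd : ∀ s ∈ τ '' J, HasDerivAt e.symm (w (e.symm s))⁻¹ s := fun s hs =>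
    e.hasDerivAt_symm hs (hpos _ (hmem s hs)).ne' (hτd _ (hmem s hs))
  refine ⟨τ '' J, e.symm, e.open_target, ?_, ⟨τ s₀, mem_image_of_mem τ hs₀⟩, ?_, ?_, hd⟩
  · exact (hJc.isPreconnected.image τ hτs.continuousOn).ordConnected
  · intro s hs
    exact (e.contDiffAt_symm_deriv (hpos _ (hmem s hs)).ne' hs (hτd _ (hmem s hs))
      (hτs.contDiffAt (hJ.mem_nhds (hmem s hs)))).contDiffWithinAt
  · exact e.symm.bijOn

/-- Here `(p, q)` is the velocity and the first factor on the right is `Q'`, free of `c`. Together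
with the second equation this shows that `c` enters the acceleration only through `Q' p / Q` times
the velocity. -/
lemma geodesic_equation_fst {μ : ℝ} (hμ : 0 < μ) {c d x : ℝ} (hx : x ∈ I c d) (a p q : ℝ) :
    a + deriv (S μ c d).E x / (2 * (S μ c d).E x) * p ^ 2
        - deriv (S μ c d).G x / (2 * (S μ c d).E x) * q ^ 2 = 0 ↔
      a = (2 * x + 2 * d / x ^ 3) * (p ^ 2 / Q c d x - q ^ 2 / (2 * μ ^ 2)) := by
  rw [(hasDerivAt_S_E μ hx).deriv, (hasDerivAt_S_G hμ hx).deriv]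
  have hQ := hx.2.1.ne'
  simp only [S]
  generalize 2 * x + 2 * d / x ^ 3 = D
  rw [← sub_eq_zero (a := a)]
  refine Eq.congr ?_ rfl
  field_simp
  ring

lemma geodesic_equation_snd {μ : ℝ} (hμ : 0 < μ) {c d x : ℝ} (hx : x ∈ I c d) (b p q : ℝ) :
    b + deriv (S μ c d).G x / (S μ c d).G x * p * q = 0 ↔
      b = (2 * x + 2 * d / x ^ 3) * (p * q / Q c d x) := by
  rw [(hasDerivAt_S_G hμ hx).deriv]
  have hQ := hx.2.1.ne'
  simp only [S]
  generalize 2 * x + 2 * d / x ^ 3 = D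
  rw [← sub_eq_zero (a := b)]
  refine Eq.congr ?_ rfl
  field_simp
  ring

lemma contDiffOn_Q_comp {c d : ℝ} {x : ℝ → ℝ} {J : Set ℝ} (hx : ContDiffOn ℝ ∞ x J)
    (h0 : ∀ s ∈ J, x s ≠ 0) : ContDiffOn ℝ ∞ (fun s => Q c d (x s)) J :=
  ((hx.pow 2).add contDiffOn_const).sub
    (contDiffOn_const.div (hx.pow 2) fun s hs => pow_ne_zero 2 (h0 s hs))

lemma hasDerivAt_deriv {x : ℝ → ℝ} {J : Set ℝ} (hJ : IsOpen J) (hx : ContDiffOn ℝ ∞ x J) {s : ℝ}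
    (hs : s ∈ J) : HasDerivAt x (deriv x s) s ∧ HasDerivAt (deriv x) (deriv (deriv x) s) s := by
  obtain ⟨h1, h2⟩ := (contDiffOn_infty_iff_deriv_of_isOpen hJ).1 hx
  exact ⟨(h1.differentiableAt (hJ.mem_nhds hs)).hasDerivAt,
    ((h2.differentiableOn (by simp)).differentiableAt (hJ.mem_nhds hs)).hasDerivAt⟩

/-- The metrics with the same `d` are geodesically equivalent: the affine parameters satisfy
`dτ / ds = Q_{c,k⁴d}(x) / Q_{c₀,d}(x / k)`. -/
lemma IsGeodesicOn.exists_rescale {μ k : ℝ} (hμ : 0 < μ) (hk : 0 < k) {c d c₀ d₀ : ℝ}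
    (hd : d = k ^ 4 * d₀) {u : ℝ → Cyl} {J : Set ℝ} (h : IsGeodesicOn (S μ c d) u J)
    (hu : ∀ s ∈ J, (u s).1 / k ∈ I c₀ d₀) :
    ∃ (J' : Set ℝ) (σ : ℝ → ℝ), ContDiffOn ℝ ∞ σ J' ∧ BijOn σ J' J ∧
      (∀ s ∈ J', deriv σ s ≠ 0) ∧ IsGeodesicOn (S μ c₀ d₀) (rescale k ∘ u ∘ σ) J' := by
  obtain ⟨hJ, hJc, hJn, x, t, hx, ht, H⟩ := h
  have hxk : ∀ s ∈ J, x s / k ∈ I c₀ d₀ := fun s hs => by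
    have := hu s hs
    rwa [(H s hs).1] at this
  have hxI : ∀ s ∈ J, x s ∈ I c d := fun s hs => (H s hs).2.1
  have hw : ContDiffOn ℝ ∞ (fun s => Q c d (x s) / Q c₀ d₀ (x s / k)) J :=
    (contDiffOn_Q_comp hx fun s hs => (hxI s hs).1.ne).div
      (contDiffOn_Q_comp (hx.div_const k) fun s hs => (hxk s hs).1.ne)
      fun s hs => (hxk s hs).2.1.ne'
  obtain ⟨J', σ, hJ', hJc', hJn', hσ, hbij, hσd⟩ := exists_reparametrization hJ hJc hJn hw
    fun s hs => div_pos (hxI s hs).2.1 (hxk s hs).2.1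
  set g : ℝ → ℝ := fun s => Q c₀ d₀ (x s / k) / Q c d (x s) with hg
  have hσd : ∀ r ∈ J', HasDerivAt σ (g (σ r)) r := fun r hr => by
    have := hσd r hr
    rwa [inv_div] at this
  have hg0 : ∀ s ∈ J, g s ≠ 0 := fun s hs => (div_pos (hxk s hs).2.1 (hxI s hs).2.1).ne'
  refine ⟨J', σ, hσ, hbij, fun r hr => ?_, hJ', hJc', hJn', fun r => x (σ r) / k,
    fun r => t (σ r), (hx.comp hσ hbij.mapsTo).div_const k, ht.comp hσ hbij.mapsTo, ?_⟩
  · rw [(hσd r hr).deriv]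
    exact hg0 _ (hbij.mapsTo hr)
  have hy1 : ∀ r ∈ J', HasDerivAt (fun r => x (σ r) / k) (deriv x (σ r) * g (σ r) / k) r :=
    fun r hr => (((hasDerivAt_deriv hJ hx (hbij.mapsTo hr)).1.comp r (hσd r hr)).div_const k)
  have ht1 : ∀ r ∈ J', HasDerivAt (fun r => t (σ r)) (deriv t (σ r) * g (σ r)) r :=
    fun r hr => (hasDerivAt_deriv hJ ht (hbij.mapsTo hr)).1.comp r (hσd r hr)
  intro r hr
  have hs := hbij.mapsTo hr
  obtain ⟨hus, hxs, hne, e1, e2⟩ := H (σ r) hs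
  set s := σ r with hs_def
  have hyd : deriv (fun r => x (σ r) / k) =ᶠ[𝓝 r] fun r => deriv x (σ r) * g (σ r) / k := by
    filter_upwards [hJ'.mem_nhds hr] with q hq using (hy1 q hq).deriv
  have htd : deriv (fun r => t (σ r)) =ᶠ[𝓝 r] fun r => deriv t (σ r) * g (σ r) := by
    filter_upwards [hJ'.mem_nhds hr] with q hq using (ht1 q hq).deriv
  have hgs : HasDerivAt g (((2 * (x s / k) + 2 * d₀ / (x s / k) ^ 3) * (deriv x s / k) * Q c d (x s)
      - Q c₀ d₀ (x s / k) * ((2 * x s + 2 * d / x s ^ 3) * deriv x s)) / Q c d (x s) ^ 2) s := by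
    have hxd := (hasDerivAt_deriv hJ hx hs).1
    exact ((hasDerivAt_Q c₀ d₀ (hxk s hs).1.ne).comp s (hxd.div_const k)).div
      ((hasDerivAt_Q c d hxs.1.ne).comp s hxd) hxs.2.1.ne'
  have hgr := hgs.comp r (hσd r hr)
  have hy2 := (((hasDerivAt_deriv hJ hx hs).2.comp r (hσd r hr)).mul hgr).div_const k
  have ht2 := ((hasDerivAt_deriv hJ ht hs).2.comp r (hσd r hr)).mul hgr
  have hy2 := hyd.deriv_eq.trans hy2.deriv
  have ht2 := htd.deriv_eq.trans ht2.deriv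
  have hyr := (hy1 r hr).deriv
  have htr := (ht1 r hr).deriv
  rw [geodesic_equation_fst hμ hxs] at e1
  rw [geodesic_equation_snd hμ hxs] at e2
  have hQ := hxs.2.1.ne'
  have hQ₀ := (hxk s hs).2.1.ne'
  -- `Q'` on the two surfaces agrees up to the factor `k`; this is the only place where `d = k⁴ d₀`
  -- matters.
  have hD : 2 * x s + 2 * d / x s ^ 3 = k * (2 * (x s / k) + 2 * d₀ / (x s / k) ^ 3) := by
    have := hxs.1.ne
    rw [hd]
    field_simp
  have hgval : g s = Q c₀ d₀ (x s / k) / Q c d (x s) := rfl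
  refine ⟨?_, hxk s hs, ?_, ?_, ?_⟩
  · simp only [Function.comp_apply, rescale, cov, ← hs_def, hus]
  · rw [hyr, htr]
    intro h0
    rw [Prod.mk.injEq] at h0
    apply hne
    refine Prod.ext ?_ ?_
    · simpa [hg0 (σ r) hs, hk.ne'] using h0.1
    · simpa [hg0 (σ r) hs] using h0.2
  · rw [geodesic_equation_fst hμ (hxk s hs), hy2, hyr, htr]
    simp only [Function.comp_apply, ← hs_def]
    rw [e1, hD, hgval]
    generalize 2 * (x s / k) + 2 * d₀ / (x s / k) ^ 3 = D
    field_simp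
    ring
  · rw [geodesic_equation_snd hμ (hxk s hs), ht2, hyr, htr]
    simp only [Function.comp_apply, ← hs_def]
    rw [e2, hD, hgval]
    generalize 2 * (x s / k) + 2 * d₀ / (x s / k) ^ 3 = D
    field_simp
    ring

lemma IsUnparamGeodesicOn.rescale {μ k : ℝ} (hμ : 0 < μ) (hk : 0 < k) {c d c₀ d₀ : ℝ}
    (hd : d = k ^ 4 * d₀) {u : ℝ → Cyl} {J : Set ℝ} (h : IsUnparamGeodesicOn (S μ c d) u J)
    (hu : ∀ s ∈ J, (u s).1 / k ∈ I c₀ d₀) :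
    IsUnparamGeodesicOn (S μ c₀ d₀) (Bertrand.rescale k ∘ u) J := by
  obtain ⟨J', σ, hσ, hbij, hσ0, hgeo⟩ := h
  have hJ' := hgeo.1
  obtain ⟨J'', ρ, hρ, hbij', hρ0, hgeo'⟩ :=
    hgeo.exists_rescale hμ hk hd fun s hs => hu _ (hbij.mapsTo hs)
  refine ⟨J'', σ ∘ ρ, hσ.comp hρ hbij'.mapsTo, hbij.comp hbij', fun s hs => ?_, hgeo'⟩
  have h1 := (hasDerivAt_deriv hJ' hσ (hbij'.mapsTo hs)).1
  have h2 := (hasDerivAt_deriv hgeo'.1 hρ hs).1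
  rw [(h1.comp s h2).deriv]
  exact mul_ne_zero (hσ0 _ (hbij'.mapsTo hs)) (hρ0 s hs)

lemma image_rescale_points (k μ c d : ℝ) :
    rescale k '' (S μ c d).points = ((fun x => x / k) '' I c d) ×ˢ univ := by
  rw [rescale_eq]
  exact (prodMap_image_prod _ _ _ _).trans (by rw [image_univ, range_id]; rfl)

lemma isProjectiveEmbedding_rescale {μ k : ℝ} (hμ : 0 < μ) (hk : 0 < k) {c d c₀ d₀ : ℝ}
    (hd : d = k ^ 4 * d₀) (hI : ∀ x ∈ I c d, x / k ∈ I c₀ d₀) :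
    IsProjectiveEmbedding (S μ c d) (S μ c₀ d₀) (rescale k) := by
  refine ⟨?_, ?_, fun u J hu => ⟨fun h => h.rescale hμ hk hd fun s hs => hI _ (hu hs).1,
    fun h => ?_⟩⟩
  · rintro _ ⟨p, hp, rfl⟩
    exact ⟨hI _ hp.1, mem_univ _⟩
  · rw [image_rescale_points]
    refine isDiffeoOn_prodMap_id (g' := fun x => k * x) (isOpen_I _ _) ?_
      (fun x _ => contDiffAt_div_const k x) (fun x _ => contDiffAt_const.mul contDiffAt_id)
      (mapsTo_image _ _) ?_ (invOn_div hk _ _)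
    · simp only [div_eq_mul_inv]
      exact (Homeomorph.mulRight₀ k⁻¹ (inv_ne_zero hk.ne')).isOpenMap _ (isOpen_I c d)
    · rintro _ ⟨x, hx, rfl⟩
      simpa only [mul_div_cancel₀ x hk.ne'] using hx
  -- The converse is the same statement for the inverse rescaling, by `k⁻¹`.
  · have hinv : rescale k⁻¹ ∘ rescale k ∘ u = u := by
      ext s
      · simp [rescale, hk.ne']
      · rfl
    have := h.rescale (k := k⁻¹) (c₀ := c) (d₀ := d) hμ (inv_pos.2 hk)
      (by rw [hd]; field_simp) (fun s hs => by
        have : (u s).1 ∈ I c d := (hu hs).1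
        simpa [rescale, hk.ne'] using this)
    rwa [hinv] at this


/-! ### Normalization along the orbits met by `γ`. -/

lemma eq_of_pow_mul_eq {a b : ℝ} (ha : 0 < a) (hb : 0 < b) {v : ℝ × ℝ} (hv : v ≠ (0, 0))
    (h1 : a ^ 2 * v.1 = b ^ 2 * v.1) (h2 : a ^ 4 * v.2 = b ^ 4 * v.2) : a = b := by
  by_cases h : v.1 = 0
  · have h' : v.2 ≠ 0 := fun h' => hv (Prod.ext h h')
    exact (pow_left_inj₀ ha.le hb.le four_ne_zero).1 (mul_right_cancel₀ h' h2)
  · exact (pow_left_inj₀ ha.le hb.le two_ne_zero).1 (mul_right_cancel₀ h h1)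

/-- The two values of `γ` lie on one orbit, with `l = κ²`, so their parameters coincide. A scaling
that fixes a point other than the origin is trivial. -/
lemma IsTransversal.eq_of_scaling {γ : Icc (0 : ℝ) (2 * Real.pi) → ℝ × ℝ} (hγ : IsTransversal γ)
    {κ : ℝ} (hκ : 0 < κ) {φ₁ φ₂ : Icc (0 : ℝ) (2 * Real.pi)}
    (hc : (γ φ₁).1 = κ ^ 2 * (γ φ₂).1) (hd : (γ φ₁).2 = κ ^ 4 * (γ φ₂).2) :
    φ₁ = φ₂ ∧ (γ φ₁ ≠ (0, 0) → κ = 1) := by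
  have h : φ₁ = φ₂ := (hγ (γ φ₂).1 (γ φ₂).2).unique
    ⟨κ ^ 2, by positivity, Prod.ext hc (by simp only [hd]; ring)⟩
    ⟨1, one_pos, by simp⟩
  subst h
  exact ⟨rfl, fun hv => eq_of_pow_mul_eq hκ one_pos hv (by linear_combination -hc)
    (by linear_combination -hd)⟩

lemma IsTransversal.existsUnique_normalization {γ : Icc (0 : ℝ) (2 * Real.pi) → ℝ × ℝ}
    (hγ : IsTransversal γ) (c d : ℝ) :
    ∃! q : ℝ × Icc (0 : ℝ) (2 * Real.pi), IsNormalization γ c d q.1 q.2 := by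
  obtain ⟨φ, ⟨l, hl, hφ⟩, huniq⟩ := hγ c d
  have hex : ∃ lam, IsNormalization γ c d lam φ := by
    by_cases h0 : γ φ = (0, 0)
    · rw [h0, Prod.mk.injEq] at hφ
      refine ⟨1, one_pos, fun _ => rfl, ?_, ?_⟩
      · rw [h0]
        simpa using (mul_eq_zero.1 hφ.1.symm).resolve_left hl.ne'
      · rw [h0]
        simpa using (mul_eq_zero.1 hφ.2.symm).resolve_left (pow_ne_zero 2 hl.ne')
    -- Since `γ φ = (l c, l² d)`, the required factor is `lam = l ^ (-1/2)`.
    · have h2 : (√l)⁻¹ ^ 2 = l⁻¹ := by rw [inv_pow, Real.sq_sqrt hl.le]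
      have h4 : (√l)⁻¹ ^ 4 = (l ^ 2)⁻¹ := by
        rw [show (√l)⁻¹ ^ 4 = ((√l)⁻¹ ^ 2) ^ 2 by ring, h2, inv_pow]
      refine ⟨(√l)⁻¹, by positivity, fun h => absurd h h0, ?_, ?_⟩
      · rw [h2, hφ]; field_simp
      · rw [h4, hφ]; field_simp
  obtain ⟨lam, hlam⟩ := hex
  refine ⟨(lam, φ), hlam, ?_⟩
  rintro ⟨lam', φ'⟩ ⟨hpos, hone, hc, hd⟩
  simp only at hpos hone hc hd
  obtain rfl : φ' = φ := huniq φ' ⟨(lam' ^ 2)⁻¹, by positivity, Prod.ext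
    (by rw [hc]; field_simp) (by rw [hd]; field_simp)⟩
  obtain ⟨hpos', hone', hc', hd'⟩ := hlam
  refine Prod.ext ?_ rfl
  by_cases h0 : γ φ' = (0, 0)
  · exact (hone h0).trans (hone' h0).symm
  · exact eq_of_pow_mul_eq hpos hpos' h0 (hc.symm.trans hc') (hd.symm.trans hd')

/-! ### Explicit description of the domains. -/

lemma I_zero_of_nonneg {c : ℝ} (hc : 0 ≤ c) : I c 0 = Iio 0 := by
  ext x
  rw [mem_I, mem_Iio, and_iff_left_iff_imp]
  intro hx
  have h2 : 0 < x ^ 2 := by have := hx.ne; positivity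
  have h4 : 0 < x ^ 4 := by have := hx.ne; positivity
  exact ⟨by nlinarith [mul_nonneg hc h2.le], by simpa using hx.ne⟩

lemma neg_sqrt_gt_iff {x X : ℝ} (hx : x < 0) (hX : 0 ≤ X) : x < -√X ↔ X < x ^ 2 := by
  rw [lt_neg, Real.sqrt_lt hX (by linarith), neg_sq]

lemma neg_sqrt_lt_iff {x X : ℝ} (hx : x < 0) : -√X < x ↔ x ^ 2 < X := by
  rw [neg_lt, Real.lt_sqrt (by linarith), neg_sq]

lemma I_zero_of_neg {c : ℝ} (hc : c < 0) : I c 0 = Iio (-√(-c)) := by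
  ext x
  rw [mem_I, mem_Iio]
  have h0 := Real.sqrt_nonneg (-c)
  constructor
  · rintro ⟨hx, hQ, -⟩
    rw [neg_sqrt_gt_iff hx (by linarith)]
    have h2 : 0 < x ^ 2 := by have := hx.ne; positivity
    have : 0 < x ^ 2 * (x ^ 2 + c) := by linear_combination hQ
    linarith [pos_of_mul_pos_right this h2.le]
  · intro h
    have hx : x < 0 := by linarith
    rw [neg_sqrt_gt_iff hx (by linarith)] at h
    have h2 : 0 < x ^ 2 := by have := hx.ne; positivity
    refine ⟨hx, ?_, by simpa using hx.ne⟩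
    nlinarith [mul_pos h2 (by linarith : 0 < x ^ 2 + c)]

/-- For `d = -k⁴` one has `x⁴ + c x² - d = (x² - k²)² + (c + 2k²) x²`, which is positive unless `x²
= k²`, and there `Q'` vanishes. This is the source of the bound `-2` on `c₀`. -/
lemma mem_I_neg_iff {k c x : ℝ} (hc : -2 * k ^ 2 ≤ c) :
    x ∈ I c (-k ^ 4) ↔ x < 0 ∧ x ^ 4 ≠ k ^ 4 := by
  rw [mem_I, neg_neg]
  refine and_congr_right fun hx => and_iff_right_of_imp fun h => ?_
  have h2 : x ^ 2 - k ^ 2 ≠ 0 := fun e => h (by linear_combination (x ^ 2 + k ^ 2) * e)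
  have h3 : 0 < (x ^ 2 - k ^ 2) ^ 2 := by positivity
  nlinarith [mul_nonneg (sq_nonneg x) (by linarith : 0 ≤ c + 2 * k ^ 2)]

/-- The factorization of `θ² Q_{c,d}(θ)` in terms of the roots `X`, `Y` of `T² + c T - d`. -/
lemma exists_roots {c d : ℝ} (h : 0 < Δ c d) :
    ∃ X Y : ℝ, x₃ c d = √X ∧ y₃ c d = √Y ∧ Y < X ∧ X + Y = -c ∧ X * Y = -d := by
  have hs : √(Δ c d) ^ 2 = c ^ 2 + 4 * d := Real.sq_sqrt h.le
  have hp := Real.sqrt_pos.2 h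
  refine ⟨(-c + √(Δ c d)) / 2, (-c - √(Δ c d)) / 2, rfl, rfl, by linarith, by ring, ?_⟩
  linear_combination -hs / 4

/-- Both roots are positive and `X * Y = -d`, so the critical value `x⁴ = -d` has `x²` strictly
between them, where `Q < 0`. The condition on `Q'` thus removes nothing more. -/
lemma I_of_mem_Ω₃ {c d : ℝ} (h : (c, d) ∈ Ω₃) :
    I c d = Iio (-x₃ c d) ∪ Ioo (-y₃ c d) 0 := by
  obtain ⟨hc, hd, hΔ⟩ := h
  simp only at hc hd hΔ
  obtain ⟨X, Y, hX, hY, hYX, hsum, hprod⟩ := exists_roots hΔ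
  have hX0 : 0 < X := by linarith
  have hY0 : 0 < Y := pos_of_mul_pos_right (by linarith : 0 < X * Y) hX0.le
  ext x
  rw [mem_I, mem_union, mem_Iio, mem_Ioo, hX, hY]
  have hf : x ^ 4 + c * x ^ 2 - d = (x ^ 2 - X) * (x ^ 2 - Y) := by
    linear_combination x ^ 2 * hsum - hprod
  rw [hf]
  constructor
  · rintro ⟨hx, hQ, -⟩
    rw [neg_sqrt_gt_iff hx hX0.le, neg_sqrt_lt_iff hx]
    rcases mul_pos_iff.1 hQ with h | h
    · exact Or.inl (by linarith)
    · exact Or.inr ⟨by linarith, hx⟩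
  · rintro (h | ⟨h, hx⟩)
    · have hx : x < 0 := h.trans_le (neg_nonpos.2 (Real.sqrt_nonneg X))
      rw [neg_sqrt_gt_iff hx hX0.le] at h
      exact ⟨hx, mul_pos (by linarith) (by linarith), by nlinarith⟩
    · rw [neg_sqrt_lt_iff hx] at h
      exact ⟨hx, mul_pos_of_neg_of_neg (by linarith) (by linarith), by nlinarith [sq_nonneg x]⟩

/-- The roots have opposite signs, so only `X` bounds the domain; `x⁴ = -d` is impossible. -/
lemma I_of_pos {c d : ℝ} (hd : 0 < d) : I c d = Iio (-x₃ c d) := by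
  have hΔ : 0 < Δ c d := by unfold Δ; positivity
  obtain ⟨X, Y, hX, -, hYX, hsum, hprod⟩ := exists_roots hΔ
  have hneg : X * Y < 0 := by linarith
  obtain ⟨hX0, hY0⟩ : 0 < X ∧ Y < 0 := by
    rcases mul_neg_iff.1 hneg with h | h
    · exact h
    · linarith
  ext x
  rw [mem_I, mem_Iio, hX]
  have hf : x ^ 4 + c * x ^ 2 - d = (x ^ 2 - X) * (x ^ 2 - Y) := by
    linear_combination x ^ 2 * hsum - hprod
  have hY' : 0 < x ^ 2 - Y := by nlinarith [sq_nonneg x]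
  rw [hf, mul_pos_iff_of_pos_right hY']
  constructor
  · rintro ⟨hx, hQ, -⟩
    rw [neg_sqrt_gt_iff hx hX0.le]
    linarith
  · intro h
    have hx : x < 0 := h.trans_le (neg_nonpos.2 (Real.sqrt_nonneg X))
    rw [neg_sqrt_gt_iff hx hX0.le] at h
    exact ⟨hx, by linarith, by nlinarith [sq_nonneg (x ^ 2)]⟩

lemma image_div_Iio {k : ℝ} (hk : 0 < k) (a : ℝ) :
    (fun x => x / k) '' Iio (-a) = Iio (-(a / k)) := by
  ext y
  simp only [mem_image, mem_Iio]
  constructor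
  · rintro ⟨x, hx, rfl⟩
    rw [← neg_div]
    gcongr
  · intro h
    rw [← neg_div, lt_div_iff₀ hk] at h
    exact ⟨y * k, h, by field_simp⟩

lemma image_div_Ioo {k : ℝ} (hk : 0 < k) (a : ℝ) :
    (fun x => x / k) '' Ioo (-a) 0 = Ioo (-(a / k)) 0 := by
  ext y
  simp only [mem_image, mem_Ioo]
  constructor
  · rintro ⟨x, ⟨hx, hx'⟩, rfl⟩
    rw [← neg_div]
    exact ⟨by gcongr, div_neg_of_neg_of_pos hx' hk⟩
  · rintro ⟨h, h'⟩
    rw [← neg_div, div_lt_iff₀ hk] at h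
    exact ⟨y * k, ⟨h, mul_neg_of_neg_of_pos h' hk⟩, by field_simp⟩

lemma rescale_one : rescale 1 = id := by
  ext p <;> simp [rescale]

lemma bijOn_rescale {μ k c d c₀ d₀ : ℝ} (hk : 0 < k) (h : I c d = I (k ^ 2 * c₀) (k ^ 4 * d₀)) :
    BijOn (rescale k) (S μ c d).points (S μ c₀ d₀).points := by
  refine ⟨fun p hp => ⟨?_, mem_univ _⟩, fun p _ q _ e => ?_, fun p hp => ?_⟩
  · exact (div_mem_I_iff hk _ _ _).2 (h.subset hp.1)
  · have h1 : p.1 / k = q.1 / k := (Prod.ext_iff.1 e).1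
    exact Prod.ext ((div_left_inj' hk.ne').1 h1) (Prod.ext_iff.1 e).2
  · refine ⟨(k * p.1, p.2), ⟨?_, mem_univ _⟩, ?_⟩
    · exact h.symm.subset ((mul_mem_I_iff hk _ _ _).2 hp.1)
    · exact Prod.ext (mul_div_cancel_left₀ _ hk.ne') rfl

/-! ### The punctured Lobachevsky plane. -/

/-- For `c < 0` the surface with `d = 0` is the punctured Lobachevsky plane: with
`θ = -√(-c) coth r` the radius in the Poincaré disc is `tanh (r / 2)`. -/
lemma exists_isometry_puncturedLobachevsky {c : ℝ} (hc : c < 0) :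
    ∃ F : Cyl → Cyl, IsIsometryOn (S 1 c 0) (puncturedLobachevsky c)
      (S 1 c 0).points (puncturedLobachevsky c).points F := by
  obtain ⟨a, ha, rfl⟩ : ∃ a : ℝ, 0 < a ∧ c = -a ^ 2 :=
    ⟨√(-c), Real.sqrt_pos.2 (by linarith), by rw [Real.sq_sqrt (by linarith)]; ring⟩
  have hdom : I (-a ^ 2) 0 = Iio (-a) := by
    rw [I_zero_of_neg hc, neg_neg, Real.sqrt_sq ha.le]
  -- `g x` is the smaller root `ρ` of `ρ² - 2sρ + 1 = 0` with `s = -x / a`. The map `g'` solves the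
  -- same equation for `x`: it is the inverse of `g`, not its derivative.
  set g : ℝ → ℝ := fun x => -x / a - √((-x / a) ^ 2 - 1) with hg
  set g' : ℝ → ℝ := fun ρ => -a * (1 + ρ ^ 2) / (2 * ρ) with hg'
  have hr : ∀ x ∈ I (-a ^ 2) 0, 1 < -x / a ∧ 0 < (-x / a) ^ 2 - 1 := by
    intro x hx
    rw [hdom, mem_Iio] at hx
    have : 1 < -x / a := by rw [lt_div_iff₀ ha]; linarith
    exact ⟨this, by nlinarith⟩
  have hgx : ∀ x ∈ I (-a ^ 2) 0, ∃ r, 0 < r ∧ r = √((-x / a) ^ 2 - 1) ∧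
      (-x / a) ^ 2 = 1 + r ^ 2 ∧ g x = -x / a - r ∧ 0 < g x ∧ g x < 1 := by
    intro x hx
    obtain ⟨h1, h2⟩ := hr x hx
    have hr0 := Real.sqrt_pos.2 h2
    have hr2 := Real.sq_sqrt h2.le
    have hgr : g x = -x / a - √((-x / a) ^ 2 - 1) := rfl
    rw [hgr]
    generalize √((-x / a) ^ 2 - 1) = r at *
    generalize -x / a = s at *
    exact ⟨r, hr0, rfl, by linarith, rfl, by nlinarith, by nlinarith⟩
  have hgd : ∀ x ∈ I (-a ^ 2) 0, ContDiffAt ℝ ∞ g x := by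
    intro x hx
    have h : ContDiffAt ℝ ∞ (fun x : ℝ => -x / a) x := contDiffAt_id.neg.div_const a
    exact h.sub (((h.pow 2).sub contDiffAt_const).sqrt (hr x hx).2.ne')
  have hg'd : ∀ ρ ∈ Ioo (0 : ℝ) 1, ContDiffAt ℝ ∞ g' ρ := fun ρ hρ =>
    (contDiffAt_const.mul (contDiffAt_const.add (contDiffAt_id.pow 2))).div
      (contDiffAt_const.mul contDiffAt_id) (mul_ne_zero two_ne_zero hρ.1.ne')
  have hderiv : ∀ x ∈ I (-a ^ 2) 0,
      deriv g x = -1 / a - 2 * (-x / a) * (-1 / a) / (2 * √((-x / a) ^ 2 - 1)) := by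
    intro x hx
    have h : HasDerivAt (fun x : ℝ => -x / a) (-1 / a) x := (hasDerivAt_id x).neg.div_const a
    have h2 : HasDerivAt (fun x : ℝ => (-x / a) ^ 2 - 1) (2 * (-x / a) * (-1 / a)) x :=
      ((h.pow 2).sub_const 1).congr_deriv (by simp)
    exact (h.sub (h2.sqrt (hr x hx).2.ne')).deriv
  have hmaps : MapsTo g (I (-a ^ 2) 0) (Ioo 0 1) := fun x hx => by
    obtain ⟨r, -, -, -, -, h0, h1⟩ := hgx x hx
    exact ⟨h0, h1⟩
  have hmaps' : MapsTo g' (Ioo 0 1) (I (-a ^ 2) 0) := by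
    rintro ρ ⟨h0, h1⟩
    rw [hdom, mem_Iio, hg']
    simp only
    rw [div_lt_iff₀ (by linarith)]
    nlinarith [mul_pos ha (pow_pos (sub_pos.2 h1) 2)]
  have hinv : InvOn g' g (I (-a ^ 2) 0) (Ioo 0 1) := by
    constructor
    · intro x hx
      obtain ⟨r, hr0, -, hr2, hgr, h0, h1⟩ := hgx x hx
      have hxs : x = -a * (-x / a) := by field_simp
      have e : 1 + g x ^ 2 = 2 * (-x / a) * g x := by
        rw [hgr]
        linear_combination -hr2
      simp only [hg'] at *
      rw [e]
      field_simp
    · rintro ρ ⟨h0, h1⟩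
      have e : -g' ρ / a = (1 + ρ ^ 2) / (2 * ρ) := by
        simp only [hg']
        field_simp
      have e2 : ((1 + ρ ^ 2) / (2 * ρ)) ^ 2 - 1 = ((1 - ρ ^ 2) / (2 * ρ)) ^ 2 := by
        field_simp
        ring
      have e3 : 0 ≤ (1 - ρ ^ 2) / (2 * ρ) := div_nonneg (by nlinarith) (by linarith)
      simp only [hg, e, e2, Real.sqrt_sq e3]
      field_simp
      ring
  refine ⟨Prod.map g id, isSimilarityOn_prodMap (m := 1)
    (isDiffeoOn_prodMap_id (g' := g') (isOpen_I _ _) isOpen_Ioo hgd hg'd hmaps hmaps' hinv)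
    hgd (fun t _ => hasAffineLiftAt_id t) (fun x hx => ?_) (fun x hx => ?_)⟩
  · obtain ⟨r, hr0, hr1, hr2, hgr, h0, h1⟩ := hgx x hx
    rw [hderiv x hx, ← hr1]
    have hQ : Q (-a ^ 2) 0 x = a ^ 2 * r ^ 2 := by
      unfold Q
      field_simp at hr2
      linear_combination hr2
    have e : 1 - g x ^ 2 = 2 * r * g x := by
      rw [hgr]
      linear_combination -hr2
    -- The derivative of `g` is `g / (a r)`. Together with `1 - g² = 2 r g` and `Q = a² r²` it turns
    -- both metric identities into algebra.
    have e' : -1 / a - 2 * (-x / a) * (-1 / a) / (2 * r) = g x / (a * r) := by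
      rw [hgr]
      field_simp
      ring
    simp only [S, puncturedLobachevsky]
    rw [hQ, e, e']
    field_simp
    norm_num
  · obtain ⟨r, hr0, hr1, hr2, hgr, h0, h1⟩ := hgx x hx
    have hQ : Q (-a ^ 2) 0 x = a ^ 2 * r ^ 2 := by
      unfold Q
      field_simp at hr2
      linear_combination hr2
    have e : 1 - g x ^ 2 = 2 * r * g x := by
      rw [hgr]
      linear_combination -hr2
    simp only [S, puncturedLobachevsky]
    rw [hQ, e]
    field_simp
    norm_num


/-! ### Projective embeddings into the normal forms. -/

/-- Projective embedding of a surface with `d = 0`. -/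
lemma projective_of_d_eq_zero {μ c c₀ : ℝ} (hμ : 0 < μ) (hc₀ : 0 ≤ c₀) :
    IsProjectiveEmbedding (S μ c 0) (S μ c₀ 0) id ∧
      (0 ≤ c → BijOn id (S μ c 0).points (S μ c₀ 0).points) ∧
      (c < 0 →
        id '' (S μ c 0).points = Iio (-√(-c)) ×ˢ univ ∧
        ∃ F : Cyl → Cyl, IsIsometryOn (S 1 c 0) (puncturedLobachevsky c)
          (S 1 c 0).points (puncturedLobachevsky c).points F) := by
  refine ⟨?_, fun hc => ?_, fun hc => ⟨?_, exists_isometry_puncturedLobachevsky hc⟩⟩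
  · rw [← rescale_one]
    refine isProjectiveEmbedding_rescale hμ one_pos (by simp) fun x hx => ?_
    rw [I_zero_of_nonneg hc₀, div_one]
    exact hx.1
  · rw [← rescale_one]
    exact bijOn_rescale one_pos (by simp [I_zero_of_nonneg hc, I_zero_of_nonneg hc₀])
  · rw [image_id, RevSurface.points]
    exact congrArg (fun D : Set ℝ => D ×ˢ (univ : Set Real.Angle)) (I_zero_of_neg hc)

/-- The domain `I c (-k⁴)` lies, up to scaling, in each `I c₀ (-1)` with `-2 ≤ c₀`. -/
lemma mem_I_scaled_iff {k c₀ x : ℝ} (hc₀ : -2 ≤ c₀) :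
    x ∈ I (k ^ 2 * c₀) (k ^ 4 * -1) ↔ x < 0 ∧ x ^ 4 ≠ k ^ 4 := by
  rw [mul_neg_one]
  exact mem_I_neg_iff (by nlinarith [sq_nonneg k])

/-- On these regions `c ≥ -2√(-d)`: this is clear for `c ≥ 0`, and otherwise `Δ ≤ 0` gives `c² ≤
4k⁴`. -/
lemma lt_zero_and_bound_of_mem {k c d : ℝ} (hd : d ≠ 0) (hk4 : k ^ 4 = |d|)
    (h : (c, d) ∈ Ω₁ ∪ ℓ₄ ∪ Ω₄ ∪ ℓ₃) : d < 0 ∧ -2 * k ^ 2 ≤ c := by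
  have hd0 : d < 0 := by
    rcases h with ((h | h) | h) | h
    · exact h.2.1
    all_goals
      refine lt_of_le_of_ne ?_ hd
      simp only [ℓ₄, Ω₄, ℓ₃, Δ, mem_ofPred_eq] at h
      nlinarith [sq_nonneg c]
  refine ⟨hd0, ?_⟩
  rw [abs_of_neg hd0] at hk4
  rcases le_or_gt 0 c with hc | hc
  · nlinarith [sq_nonneg k]
  · have hΔ : Δ c d ≤ 0 := by
      rcases h with ((h | h) | h) | h
      · exact absurd h.2.2 hc.not_gt
      · exact h.2.le
      · exact le_of_lt h
      · exact h.2.le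
    unfold Δ at hΔ
    have : c ^ 2 ≤ (2 * k ^ 2) ^ 2 := by nlinarith
    have := abs_le_of_sq_le_sq' this (by positivity)
    linarith [this.1]

/-- Projective embedding of a surface with `d ≠ 0`. -/
lemma projective_of_d_ne_zero {μ c d c₀ : ℝ} (hμ : 0 < μ) (hd : d ≠ 0) (hc₀ : c₀min c d ≤ c₀) :
    IsProjectiveEmbedding (S μ c d) (S μ c₀ (Real.sign d)) (rescale (|d| ^ (1 / 4 : ℝ))) ∧
      ((c, d) ∈ Ω₁ ∪ ℓ₄ ∪ Ω₄ ∪ ℓ₃ →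
        BijOn (rescale (|d| ^ (1 / 4 : ℝ)))
          (S μ c d).points (S μ c₀ (Real.sign d)).points) ∧
      ((c, d) ∈ Ω₃ →
        rescale (|d| ^ (1 / 4 : ℝ)) '' (S μ c d).points =
          (Iio (-(x₃ c d / (-d) ^ (1 / 4 : ℝ))) ∪
            Ioo (-(y₃ c d / (-d) ^ (1 / 4 : ℝ))) 0) ×ˢ univ) ∧
      (0 < d →
        rescale (|d| ^ (1 / 4 : ℝ)) '' (S μ c d).points =
          Iio (-(x₃ c d / d ^ (1 / 4 : ℝ))) ×ˢ univ) := by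
  have hk : 0 < |d| ^ (1 / 4 : ℝ) := Real.rpow_pos_of_pos (abs_pos.2 hd) _
  have hk4 : (|d| ^ (1 / 4 : ℝ)) ^ 4 = |d| := by
    rw [← Real.rpow_natCast, ← Real.rpow_mul (abs_nonneg d)]
    norm_num
  refine ⟨?_, fun h => ?_, fun h => ?_, fun h => ?_⟩
  · generalize |d| ^ (1 / 4 : ℝ) = k at *
    rcases lt_or_gt_of_ne hd with hd0 | hd0
    · rw [abs_of_neg hd0] at hk4
      rw [Real.sign_of_neg hd0]
      rw [c₀min, if_neg hd, if_pos hd0] at hc₀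
      refine isProjectiveEmbedding_rescale hμ hk (by linarith) fun x hx => ?_
      rw [div_mem_I_iff hk, mem_I_scaled_iff hc₀, hk4]
      rw [mem_I] at hx
      exact ⟨hx.1, hx.2.2⟩
    · rw [abs_of_pos hd0] at hk4
      rw [Real.sign_of_pos hd0]
      -- With `√d = k²` the bound becomes `c ≤ k² c₀`. Raising `c` raises `Q`, so the domain can
      -- only grow.
      rw [c₀min, if_neg hd, if_neg hd0.not_gt, ← hk4, show k ^ 4 = (k ^ 2) ^ 2 by ring,
        Real.sqrt_sq (by positivity), div_le_iff₀' (by positivity)] at hc₀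
      refine isProjectiveEmbedding_rescale hμ hk (by linarith) fun x hx => ?_
      rw [div_mem_I_iff hk, mul_one, hk4, mem_I]
      rw [mem_I] at hx
      exact ⟨hx.1, by nlinarith [mul_le_mul_of_nonneg_right hc₀ (sq_nonneg x)], hx.2.2⟩
  · obtain ⟨hd0, hc⟩ := lt_zero_and_bound_of_mem hd hk4 h
    generalize |d| ^ (1 / 4 : ℝ) = k at *
    rw [abs_of_neg hd0] at hk4
    rw [Real.sign_of_neg hd0]
    rw [c₀min, if_neg hd, if_pos hd0] at hc₀
    -- Before scaling, both domains equal `{x < 0, x⁴ ≠ k⁴}`.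
    refine bijOn_rescale hk (Set.ext fun x => ?_)
    rw [mem_I_scaled_iff hc₀, ← mem_I_neg_iff hc, hk4, neg_neg]
  · have hd0 : d < 0 := h.2.1
    rw [image_rescale_points, I_of_mem_Ω₃ h, image_union, image_div_Iio hk, image_div_Ioo hk,
      abs_of_neg hd0]
  · rw [image_rescale_points, I_of_pos h, image_div_Iio hk, abs_of_pos h]

end Bertrand

theorem mainTheorem7 :
    -- (A): isometries near parallels
    (∀ μ₁ c₁ d₁ θ₁ μ₂ c₂ d₂ θ₂ : ℝ, 0 < μ₁ → 0 < μ₂ → θ₁ ∈ I c₁ d₁ → θ₂ ∈ I c₂ d₂ →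
      (μ₁, c₁, d₁, θ₁) ≠ (μ₂, c₂, d₂, θ₂) →
      ¬ IsometricNear (S μ₁ c₁ d₁) (S μ₂ c₂ d₂) (parallel θ₁) (parallel θ₂)) ∧
    -- (A): the parameter `μ` is not seen locally
    (∀ μ c d : ℝ, 0 < μ →
      LocallyIsometric (S μ c d) (S 1 c d) ∧
      ∀ t₀ : ℝ, ∃ (U V : Set Cyl) (F : Cyl → Cyl) (ε : ℝ), 0 < ε ∧
        U = {p | p.1 ∈ I c d ∧ ∃ t : ℝ, |t - t₀| < ε ∧ p.2 = (t : Real.Angle)} ∧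
        meridian (S μ c d) (t₀ : Real.Angle) ⊆ U ∧
        IsIsometryOn (S μ c d) (S 1 c d) U V F ∧
        ∀ θ ∈ I c d, ∀ t : ℝ, |t - t₀| < ε →
          F (θ, (t : Real.Angle)) = (θ, ((t / μ : ℝ) : Real.Angle))) ∧
    -- (A): isometries near points
    (∀ c₁ d₁ θ₁ c₂ d₂ θ₂ : ℝ, θ₁ ∈ I c₁ d₁ → θ₂ ∈ I c₂ d₂ →
      (c₁, d₁, θ₁) ≠ (c₂, d₂, θ₂) →
      ¬ IsometricNear (S 1 c₁ d₁) (S 1 c₂ d₂) {(θ₁, 0)} {(θ₂, 0)}) ∧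
    -- (B)
    (∀ γ : Set.Icc (0 : ℝ) (2 * Real.pi) → ℝ × ℝ, IsTransversal γ →
      -- (B): the normalization
      (∀ c d : ℝ, ∃! q : ℝ × Set.Icc (0 : ℝ) (2 * Real.pi), IsNormalization γ c d q.1 q.2) ∧
      (∀ (μ c d lam : ℝ) (φ : Set.Icc (0 : ℝ) (2 * Real.pi)), 0 < μ →
        IsNormalization γ c d lam φ →
        IsSimilarityOn lam (S μ c d) (S μ (γ φ).1 (γ φ).2)
          (S μ c d).points (S μ (γ φ).1 (γ φ).2).points (rescale lam) ∧
        LocallySimilar lam (S μ c d) (S 1 (γ φ).1 (γ φ).2)) ∧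
      -- (B): similarities near parallels
      (∀ (μ₁ μ₂ θ₁ θ₂ : ℝ) (φ₁ φ₂ : Set.Icc (0 : ℝ) (2 * Real.pi)), 0 < μ₁ → 0 < μ₂ →
        θ₁ ∈ I (γ φ₁).1 (γ φ₁).2 → θ₂ ∈ I (γ φ₂).1 (γ φ₂).2 →
        (μ₁, φ₁, θ₁) ≠ (μ₂, φ₂, θ₂) →
        ¬ (μ₁ = μ₂ ∧ γ φ₁ = (0, 0) ∧ γ φ₂ = (0, 0)) →
        ¬ ∃ κ : ℝ, 0 < κ ∧ SimilarNear κ (S μ₁ (γ φ₁).1 (γ φ₁).2) (S μ₂ (γ φ₂).1 (γ φ₂).2)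
          (parallel θ₁) (parallel θ₂)) ∧
      -- (B): similarities near points
      (∀ (θ₁ θ₂ : ℝ) (φ₁ φ₂ : Set.Icc (0 : ℝ) (2 * Real.pi)),
        θ₁ ∈ I (γ φ₁).1 (γ φ₁).2 → θ₂ ∈ I (γ φ₂).1 (γ φ₂).2 →
        (φ₁, θ₁) ≠ (φ₂, θ₂) →
        ¬ (γ φ₁ = (0, 0) ∧ γ φ₂ = (0, 0)) →
        ¬ ∃ κ : ℝ, 0 < κ ∧ SimilarNear κ (S 1 (γ φ₁).1 (γ φ₁).2) (S 1 (γ φ₂).1 (γ φ₂).2)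
          {(θ₁, 0)} {(θ₂, 0)})) ∧
    -- (C): the case `d = 0`
    (∀ μ c c₀ : ℝ, 0 < μ → c₀min c 0 ≤ c₀ →
      IsProjectiveEmbedding (S μ c 0) (S μ c₀ 0) id ∧
      (0 ≤ c → Set.BijOn id (S μ c 0).points (S μ c₀ 0).points) ∧
      (c < 0 →
        id '' (S μ c 0).points = Set.Iio (-√(-c)) ×ˢ Set.univ ∧
        ∃ F : Cyl → Cyl, IsIsometryOn (S 1 c 0) (puncturedLobachevsky c)
          (S 1 c 0).points (puncturedLobachevsky c).points F)) ∧
    -- (C): the case `d ≠ 0`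
    (∀ μ c d c₀ : ℝ, 0 < μ → d ≠ 0 → c₀min c d ≤ c₀ →
      IsProjectiveEmbedding (S μ c d) (S μ c₀ (Real.sign d)) (rescale (|d| ^ (1 / 4 : ℝ))) ∧
      ((c, d) ∈ Ω₁ ∪ ℓ₄ ∪ Ω₄ ∪ ℓ₃ →
        Set.BijOn (rescale (|d| ^ (1 / 4 : ℝ)))
          (S μ c d).points (S μ c₀ (Real.sign d)).points) ∧
      ((c, d) ∈ Ω₃ →
        rescale (|d| ^ (1 / 4 : ℝ)) '' (S μ c d).points =
          (Set.Iio (-(x₃ c d / (-d) ^ (1 / 4 : ℝ))) ∪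
            Set.Ioo (-(y₃ c d / (-d) ^ (1 / 4 : ℝ))) 0) ×ˢ Set.univ) ∧
      (0 < d →
        rescale (|d| ^ (1 / 4 : ℝ)) '' (S μ c d).points =
          Set.Iio (-(x₃ c d / d ^ (1 / 4 : ℝ))) ×ˢ Set.univ)) := by
  refine ⟨?_, fun μ c d hμ => ⟨?_, exists_isometry_near_meridian hμ c d⟩, ?_, fun γ hγ =>
    ⟨hγ.existsUnique_normalization, ?_, ?_, ?_⟩, ?_, ?_⟩
  · intro μ₁ c₁ d₁ θ₁ μ₂ c₂ d₂ θ₂ hμ₁ hμ₂ _ _ hne h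
    obtain ⟨rfl, hc, hd, rfl⟩ := SimilarNear.eq_of_parallels one_pos hμ₁ hμ₂ h
    simp only [one_pow, one_mul] at hc hd
    simp [hc, hd] at hne
  · simpa [LocallyIsometric] using locallySimilar hμ one_pos one_pos c d
  · intro c₁ d₁ θ₁ c₂ d₂ θ₂ _ _ hne h
    obtain ⟨hc, hd, rfl⟩ := SimilarNear.eq_of_points one_pos one_pos one_pos h
    simp only [one_pow, one_mul] at hc hd
    simp [hc, hd] at hne
  · rintro μ _ _ lam φ hμ ⟨hlam, -, rfl, rfl⟩
    exact ⟨isSimilarityOn_rescale hμ hlam _ _, locallySimilar hμ one_pos hlam _ _⟩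
  · rintro μ₁ μ₂ θ₁ θ₂ φ₁ φ₂ hμ₁ hμ₂ - - hne h0 ⟨κ, hκ, h⟩
    obtain ⟨rfl, hc, hd, rfl⟩ := SimilarNear.eq_of_parallels hκ hμ₁ hμ₂ h
    obtain ⟨rfl, hone⟩ := hγ.eq_of_scaling hκ hc hd
    -- At the origin of the parameter plane every rescaling is a self-similarity; `h0` excludes
    -- exactly this case.
    have hκ1 := hone fun e => h0 ⟨rfl, e, e⟩
    simp [hκ1] at hne
  · rintro θ₁ θ₂ φ₁ φ₂ - - hne h0 ⟨κ, hκ, h⟩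
    obtain ⟨hc, hd, rfl⟩ := SimilarNear.eq_of_points hκ one_pos one_pos h
    obtain ⟨rfl, hone⟩ := hγ.eq_of_scaling hκ hc hd
    have hκ1 := hone fun e => h0 ⟨e, e⟩
    simp [hκ1] at hne
  · intro μ c c₀ hμ hc₀
    rw [c₀min, if_pos rfl] at hc₀
    exact projective_of_d_eq_zero hμ hc₀
  · exact fun μ c d c₀ hμ hd hc₀ => projective_of_d_ne_zero hμ hd hc₀
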